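/- Let $\mathbb K$ be a field of characteristic zero, let $\mathbb K[x,\partial]=\mathbb K\langle x,\partial;\ \partial x=x\partial+1\rangle$, and let $\mathbb K[x,\partial]_{d,r}$ be the set of operators $L=\sum_{i<d,\,j<r}L_{i,j}\,x^i\partial^j$ with $L_{i,j}\in\mathbb K$. Let $\mathbb K[x]_k$ be the set of polynomials of degree less than $k$. Costs are numbers of operations $+,-,\times,/$ in $\mathbb K$ performed by straight-line programs over $\mathbb K$ (constants of $\mathbb K$ are free, no division by zero may occur). Let $\mathsf M$ be a multiplication time: for each $n\ge 1$, two polynomials in $\mathbb K[x]_n$ can be multiplied within $\mathsf M(n)$ operations, and $\mathsf M(n)/n$ is nondecreasing for $n\ge1$. Let $r\ge d\ge 1$, $p=\lceil r/d\rceil$, and let $\alpha_0,\dots,\alpha_{p-1}\in\mathbb K$ be pairwise distinct. An operator $L\in\mathbb K[x,\partial]_{d,r}$ maps $\bigoplus_{i<p}\mathbb K[x]_d\,\mathrm e^{\alpha_i x}$ to $\bigoplus_{i<p}\mathbb K[x]_{2d}\,\mathrm e^{\alpha_i x}$; let $\Phi_L^{[2d,d]}$ be its matrix with respect to the bases $(x^j\mathrm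 e^{\alpha_i x})$ with $i<p$, and $j<d$ resp. $j<2d$. This matrix is block diagonal with $p$ blocks of size $2d\times d$; the $i$-th block is the matrix, in the monomial bases, of the map $\mathbb K[x]_d\to\mathbb K[x]_{2d}$ given by the operator $L_{\ltimes\alpha_i}$ obtained from $L$ by substituting $\partial+\alpha_i$ for $\partial$. Moreover, there is an absolute constant $C$ such that: 1. $\Phi_L^{[2d,d]}$ can be computed from the points $\alpha_i$ and the coefficients of $L$ within $C\,d\,\mathsf M(r)\log r$ operations; 2. conversely, $L$ is uniquely determined by $\Phi_L^{[2d,d]}$ among the elements of $\mathbb K[x,\partial]_{d,r}$, and its coefficients can be computed from the points $\alpha_i$ and $\Phi_L^{[2d,d]}$ within $C\,d\,\mathsf M(r)\log r$ operations. In both cases, for given $\mathbb K$, $\mathsf M$, $d$, $r$ a single straight-line program works for all choices of pairwise distinct $\alpha_i$ and all $L\in\mathbb K[x,\partial]_{d,r}$. -/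

import Mathlib

/-! ### Straight-line programs over a field, with their number of operations -/

/-- The four field operations. -/
inductive FieldOp where
  | add | sub | mul | div

/-- What an instruction may read: an input, a constant of the field, or the result of the
`n`-th instruction (counted from `0`). -/
inductive Operand (K : Type*) (ι : Type*) where
  | input (i : ι)
  | const (c : K)
  | reg (n : ℕ)

/-- One instruction: one field operation applied to two operands. -/
structure Instr (K : Type*) (ι : Type*) where
  op : FieldOp
  left : Operand K ι
  right : Operand K ι

/-- A straight-line program with inputs indexed by `ι` and outputs indexed by `o`. -/
structure SLP (K : Type*) (ι : Type*) (o : Type*) where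
  code : List (Instr K ι)
  out : o → Operand K ι

/-- The value of an operand on the input `x`, where `regs` lists the results computed so far;
it is undefined for a result that is not yet available. -/
def Operand.value {K ι : Type*} (x : ι → K) (regs : List K) : Operand K ι → Option K
  | .input i => some (x i)
  | .const c => some c
  | .reg n => regs[n]?

open Classical in
/-- The field operations; a division by zero is undefined. -/
noncomputable def FieldOp.apply {K : Type*} [Field K] : FieldOp → K → K → Option K
  | .add, a, b => some (a + b)
  | .sub, a, b => some (a - b)
  | .mul, a, b => some (a * b)
  | .div, a, b => if b = 0 then none else some (a / b)

/-- Execute one instruction. -/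
noncomputable def Instr.exec {K ι : Type*} [Field K] (x : ι → K) (regs : List K)
    (s : Instr K ι) : Option K :=
  (s.left.value x regs).bind fun a => (s.right.value x regs).bind fun b => s.op.apply a b

/-- Execute a list of instructions one after the other, appending each result to the list of
available results. -/
noncomputable def runCode {K ι : Type*} [Field K] (x : ι → K) :
    List (Instr K ι) → List K → Option (List K)
  | [], regs => some regs
  | s :: code, regs => (s.exec x regs).bind fun v => runCode x code (regs ++ [v])

namespace SLP

/-- On the input `x` the program runs without any division by zero and outputs `y`. -/
def Computes {K ι o : Type*} [Field K] (P : SLP K ι o) (x : ι → K) (y : o → K) : Prop :=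
  ∃ regs, runCode x P.code [] = some regs ∧ ∀ k, (P.out k).value x regs = some (y k)

/-- The number of field operations that the program performs. -/
def cost {K ι o : Type*} (P : SLP K ι o) : ℕ := P.code.length

end SLP

/-- The polynomial of degree less than `n` with given coefficients. -/
noncomputable def polyOfCoeffs {K : Type*} [Field K] {n : ℕ} (a : Fin n → K) : Polynomial K :=
  ∑ i : Fin n, Polynomial.monomial (i : ℕ) (a i)

/-- `M` is a multiplication time over `K`: for every `n ≥ 1` two polynomials of degree less
than `n` can be multiplied within `M n` field operations, and `M n / n` is a nondecreasing
function of `n ≥ 1`. -/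
def IsMulTime (K : Type*) [Field K] (M : ℕ → ℝ) : Prop :=
  (∀ n : ℕ, 1 ≤ n → ∃ P : SLP K (Fin n ⊕ Fin n) (Fin (2 * n - 1)), (P.cost : ℝ) ≤ M n ∧
    ∀ a b : Fin n → K, P.Computes (Sum.elim a b)
      (fun k => (polyOfCoeffs a * polyOfCoeffs b).coeff k)) ∧
  MonotoneOn (fun n : ℕ => M n / (n : ℝ)) (Set.Ici 1)

/-! ### Linear differential operators with polynomial coefficients -/

/-- The relation `∂ x = x ∂ + 1` on the free algebra on `x` (`false`) and `∂` (`true`). -/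
inductive WeylRel (K : Type*) [Field K] : FreeAlgebra K Bool → FreeAlgebra K Bool → Prop
  | comm : WeylRel K (FreeAlgebra.ι K true * FreeAlgebra.ι K false)
      (FreeAlgebra.ι K false * FreeAlgebra.ι K true + 1)

/-- The algebra `K[x, ∂]` of linear differential operators, `K⟨x, ∂; ∂ x = x ∂ + 1⟩`. -/
abbrev DiffOp (K : Type*) [Field K] : Type _ := RingQuot (WeylRel K)

namespace DiffOp

/-- The operator `x`. -/
noncomputable def x (K : Type*) [Field K] : DiffOp K :=
  RingQuot.mkAlgHom K (WeylRel K) (FreeAlgebra.ι K false)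

/-- The operator `∂`. -/
noncomputable def del (K : Type*) [Field K] : DiffOp K :=
  RingQuot.mkAlgHom K (WeylRel K) (FreeAlgebra.ι K true)

theorem del_mul_x (K : Type*) [Field K] : del K * x K = x K * del K + 1 := by
  have h := RingQuot.mkAlgHom_rel K (WeylRel.comm (K := K))
  simpa [x, del] using h

/-- The algebra morphism with `x ↦ a` and `∂ ↦ b`, for `b * a = a * b + 1`. -/
noncomputable def lift {K : Type*} [Field K] {A : Type*} [Ring A] [Algebra K A] (a b : A)
    (h : b * a = a * b + 1) : DiffOp K →ₐ[K] A :=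
  RingQuot.liftAlgHom K ⟨FreeAlgebra.lift K fun t => if t then b else a, by
    rintro _ _ ⟨⟩
    simpa using h⟩

@[simp] theorem lift_x {K : Type*} [Field K] {A : Type*} [Ring A] [Algebra K A] (a b : A)
    (h : b * a = a * b + 1) : lift (K := K) a b h (x K) = a := by
  simp [lift, x]

@[simp] theorem lift_del {K : Type*} [Field K] {A : Type*} [Ring A] [Algebra K A] (a b : A)
    (h : b * a = a * b + 1) : lift (K := K) a b h (del K) = b := by
  simp [lift, del]

/-- The operator `∑_{i < d, j < r} c_{i,j} x^i ∂^j`. -/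
noncomputable def ofCoeffs {K : Type*} [Field K] {d r : ℕ} (c : Fin d × Fin r → K) : DiffOp K :=
  ∑ i : Fin d, ∑ j : Fin r, c (i, j) • (x K ^ (i : ℕ) * del K ^ (j : ℕ))

/-- `K[x, ∂]_{d,r}`: the operators of degree less than `d` in `x` and less than `r` in `∂`. -/
def bidegreeLT (K : Type*) [Field K] (d r : ℕ) : Set (DiffOp K) :=
  Set.range (ofCoeffs (K := K) (d := d) (r := r))

/-- The action of `K[x, ∂]` on `K[x]`, where `∂` acts as `d/dx`. -/
noncomputable def polyAction (K : Type*) [Field K] :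
    DiffOp K →ₐ[K] Module.End K (Polynomial K) :=
  lift (LinearMap.mulLeft K Polynomial.X) Polynomial.derivative (by
    refine LinearMap.ext fun P => ?_
    simp [Polynomial.derivative_mul, add_comm])

/-- The matrix of size `m × k` with entries `L(x^j)_i`, for `i < m` and `j < k`. -/
noncomputable def polyMatrix {K : Type*} [Field K] (m k : ℕ) (L : DiffOp K) :
    Matrix (Fin m) (Fin k) K :=
  Matrix.of fun i j => (polyAction K L (Polynomial.X ^ (j : ℕ))).coeff i

/-- The twist of `L`: the operator obtained by substituting `∂ + a` for `∂` in `L`. -/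
noncomputable def twist {K : Type*} [Field K] (a : K) : DiffOp K →ₐ[K] DiffOp K :=
  lift (x K) (del K + algebraMap K (DiffOp K) a) (by
    rw [add_mul, mul_add, del_mul_x, Algebra.commutes]
    abel)

end DiffOp

/-! ### Exponential polynomials -/

/-- The space of exponential polynomials `∑_a P_a e^{a x}`, the direct sum over `a ∈ K` of the
spaces `K[x] e^{a x}`; the element `P e^{a x}` is `Finsupp.single a P`. -/
abbrev ExpPoly (K : Type*) [Field K] : Type _ := K →₀ Polynomial K

namespace ExpPoly

/-- Multiplication by `x`. -/
noncomputable def mulX (K : Type*) [Field K] : Module.End K (ExpPoly K) :=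
  Finsupp.mapRange.linearMap (LinearMap.mulLeft K Polynomial.X)

/-- The derivation `d/dx`, with `(P e^{a x})' = (P' + a P) e^{a x}`. -/
noncomputable def deriv (K : Type*) [Field K] : Module.End K (ExpPoly K) :=
  Finsupp.lsum K fun a : K =>
    (Finsupp.lsingle a : Polynomial K →ₗ[K] ExpPoly K) ∘ₗ
      (Polynomial.derivative + a • LinearMap.id)

@[simp] theorem mulX_single {K : Type*} [Field K] (a : K) (P : Polynomial K) :
    mulX K (Finsupp.single a P) = Finsupp.single a (Polynomial.X * P) := by
  simp [mulX]

@[simp] theorem deriv_single {K : Type*} [Field K] (a : K) (P : Polynomial K) :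
    deriv K (Finsupp.single a P) = Finsupp.single a (Polynomial.derivative P + a • P) := by
  simp [deriv]

/-- The action of `K[x, ∂]` on exponential polynomials, where `∂` acts as `d/dx`. -/
noncomputable def action (K : Type*) [Field K] : DiffOp K →ₐ[K] Module.End K (ExpPoly K) :=
  DiffOp.lift (mulX K) (deriv K) (by
    refine Finsupp.lhom_ext fun a P => ?_
    simp only [Module.End.mul_apply, LinearMap.add_apply, mulX_single, deriv_single,
      Module.End.one_apply, ← Finsupp.single_add]
    congr 1
    simp only [Polynomial.derivative_mul, Polynomial.derivative_X, mul_add, mul_smul_comm]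
    ring)

/-- The exponential polynomial `x^j e^{a x}`. -/
noncomputable def mono {K : Type*} [Field K] (a : K) (j : ℕ) : ExpPoly K :=
  Finsupp.single a (Polynomial.X ^ j)

/-- For pairwise distinct `α_0, …, α_{p-1}`: the matrix whose columns hold the coordinates of
the images `L(x^j e^{α_i x})`, for `i < p` and `j < k`, on the family of all `x^l e^{α_i x}` with
`i < p` and `l < m`. -/
noncomputable def matrix {K : Type*} [Field K] {p : ℕ} (α : Fin p → K) (m k : ℕ)
    (L : DiffOp K) : Matrix (Fin p × Fin m) (Fin p × Fin k) K :=
  Matrix.of fun s t => (action K L (mono (α t.1) t.2) (α s.1)).coeff s.2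

end ExpPoly

/-! Conjugation by e^{αx} turns ∂ into ∂ + α, so L acts on K[x] e^{αx} as its twist acts on K[x]
(`action_single`); this gives the block diagonal shape. Write L = ∑ x^i L_i(∂) with i < d and deg
L_i < r. Twisting by α replaces L_i by its Taylor shift at α, and ∂^d kills K[x]_d, so the block at
α depends only on the Taylor expansions of the L_i at α to order d (`coeff_polyAction_X_pow`). The
matrix therefore carries the same information as the order-d expansions of the L_i at the p points.
As r ≤ pd, these determine L_i by Hermite interpolation.

Expansions and blocks are converted into each other one diagonal at a time. Since ∂^m x^j =
j!/(j-m)! x^{j-m}, the entries of a diagonal, divided by j!, are coefficients of a product with a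
truncated exponential (`blockEntry_eq`). Multiplication by exp(-X) inverts this. The conversions
amount to O(pd) products of size d.

What remains is d Hermite evaluations or interpolations of size pd < 2r, each within O(M(r) log r).
Evaluation (`MulBound.hermite_eval`) uses a scaled remainder tree: one power series inversion at the
root, then only multiplications. Interpolation (`MulBound.hermite_interp`) is a partial fraction
decomposition, whose cofactors come from evaluating the product of all moduli to order 2d.

To get one program for all inputs, the computation takes place in the ring of functions on the set
of admissible inputs. A sequence of operations on such functions is a straight-line program
(`exists_program_of_reach`), and a division is allowed exactly when the divisor is a unit, that is,
nowhere zero. Multiplication costs enter through a single rate μ proportional to M(r)/r, valid for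
all sizes up to 4r (`mulBound_of_isMulTime`). Uniqueness of L follows from the existence of the
second program. -/

namespace StraightLine

open Polynomial

/-! ### Straight-line complexity in a commutative algebra -/

section Reach

variable (K : Type*) {R : Type*} [Field K] [CommRing R] [Algebra K R]

/-- The elements that are available at no cost when those of `S` are: `S` and the constants. -/
def avail (S : Set R) : Set R := S ∪ Set.range (algebraMap K R)

/-- `v` is the result of one ring operation on `a` and `b`, or of the division of `a` by the
unit `b`. -/
def IsOp (a b v : R) : Prop :=
  v = a + b ∨ v = a - b ∨ v = a * b ∨ (IsUnit b ∧ v * b = a)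

/-- The elements of `T` can be obtained from those of `S` within `n` operations. -/
inductive ReachN : Set R → ℕ → Set R → Prop
  | done {S : Set R} {n : ℕ} {T : Set R} (h : T ⊆ avail K S) : ReachN S n T
  | step {S : Set R} {n : ℕ} {T : Set R} {a b v : R} (ha : a ∈ avail K S) (hb : b ∈ avail K S)
      (hv : IsOp a b v) (h : ReachN (insert v S) n T) : ReachN S (n + 1) T

/-- The elements of `T` can be obtained from those of `S` within `c` operations. -/
def Reach (S : Set R) (c : ℝ) (T : Set R) : Prop :=
  ∃ n : ℕ, (n : ℝ) ≤ c ∧ ReachN K S n T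

variable {K} {S S' T T' U : Set R}

theorem subset_avail : S ⊆ avail K S := Set.subset_union_left

theorem const_mem_avail (c : K) : algebraMap K R c ∈ avail K S := Or.inr ⟨c, rfl⟩

theorem zero_mem_avail : (0 : R) ∈ avail K S := by
  simpa using const_mem_avail (S := S) (0 : K)

theorem one_mem_avail : (1 : R) ∈ avail K S := by
  simpa using const_mem_avail (S := S) (1 : K)

theorem avail_subset (h : S ⊆ avail K S') : avail K S ⊆ avail K S' :=
  Set.union_subset h Set.subset_union_right

theorem avail_mono (h : S ⊆ S') : avail K S ⊆ avail K S' :=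
  avail_subset (h.trans subset_avail)

theorem ReachN.mono {n : ℕ} (h : ReachN K S n T) :
    ∀ {S' : Set R} {m : ℕ}, S ⊆ avail K S' → n ≤ m → ReachN K S' m T := by
  induction h with
  | done h => exact fun hS _ => .done (h.trans (avail_subset hS))
  | @step S n T a b v ha hb hv h ih =>
    intro S' m hS hm
    obtain ⟨m, rfl⟩ : ∃ k, m = k + 1 := ⟨m - 1, by omega⟩
    refine .step (avail_subset hS ha) (avail_subset hS hb) hv (ih ?_ (by omega))
    refine Set.insert_subset (subset_avail (Set.mem_insert _ _)) (hS.trans (avail_mono ?_))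
    exact Set.subset_insert _ _

/-- Earlier results stay available, so the continuation is required from every larger set in which
`T` is available. This avoids naming the intermediate results. -/
theorem ReachN.bind {n m : ℕ} (h : ReachN K S n T) :
    (∀ S', S ⊆ S' → T ⊆ avail K S' → ReachN K S' m U) → ReachN K S (n + m) U := by
  induction h with
  | @done S n T h => exact fun H => (H S le_rfl h).mono subset_avail (by omega)
  | @step S n T a b v ha hb hv h ih =>
    intro H
    rw [show n + 1 + m = (n + m) + 1 by ring]
    exact .step ha hb hv (ih fun S' hS hT => H S' ((Set.subset_insert _ _).trans hS) hT)

theorem Reach.mono {c c' : ℝ} (h : Reach K S c T) (hS : S ⊆ avail K S') (hc : c ≤ c') :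
    Reach K S' c' T :=
  let ⟨n, hn, h⟩ := h
  ⟨n, hn.trans hc, h.mono hS le_rfl⟩

theorem Reach.le {c c' : ℝ} (h : Reach K S c T) (hc : c ≤ c') : Reach K S c' T :=
  h.mono subset_avail hc

theorem Reach.done {c : ℝ} (hc : 0 ≤ c) (h : T ⊆ avail K S) : Reach K S c T :=
  ⟨0, by simpa using hc, .done h⟩

theorem Reach.nonneg {c : ℝ} (h : Reach K S c T) : 0 ≤ c :=
  let ⟨n, hn, _⟩ := h
  n.cast_nonneg.trans hn

/-- After computing `T` one may go on from any set that contains `S` and `T`. -/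
theorem Reach.bind {c c' : ℝ} (h : Reach K S c T)
    (H : ∀ S', S ⊆ S' → T ⊆ avail K S' → Reach K S' c' U) : Reach K S (c + c') U := by
  obtain ⟨n, hn, h⟩ := h
  have key : ReachN K S (n + ⌊c'⌋₊) U := by
    refine h.bind fun S' hS hT => ?_
    obtain ⟨m, hm, h'⟩ := H S' hS hT
    exact h'.mono subset_avail (Nat.le_floor hm)
  -- The floor of c' is a useful bound only for nonnegative c'; one instance of the continuation
  -- shows this.
  have hc' : 0 ≤ c' := (H (S ∪ avail K T) (by simp) (by
    exact (subset_avail.trans Set.subset_union_right).trans subset_avail)).nonneg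
  exact ⟨_, by push_cast; linarith [Nat.floor_le hc'], key⟩

/-- As `Reach.bind`, with the total cost given separately. -/
theorem Reach.bind' {c c' c'' : ℝ} (h : Reach K S c T) (hc : c + c' ≤ c'')
    (H : ∀ S', S ⊆ S' → T ⊆ avail K S' → Reach K S' c' U) : Reach K S c'' U :=
  (h.bind H).le hc

theorem Reach.of_subset {c : ℝ} (h : Reach K S c T) (hT : T' ⊆ avail K T) : Reach K S c T' := by
  have := h.bind (c' := 0) (U := T') fun S' _ hT' => .done le_rfl (hT.trans (avail_subset hT'))
  simpa using this

theorem Reach.union {c c' : ℝ} (h : Reach K S c T) (h' : Reach K S c' T') :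
    Reach K S (c + c') (T ∪ T') :=
  h.bind fun S' hS hT => ((h'.mono (hS.trans subset_avail) le_rfl).bind (c' := 0)
    fun S'' hS' hT' => .done le_rfl (Set.union_subset
      (hT.trans (avail_mono hS')) hT')).le (by simp)

theorem Reach.biUnion {ι : Type*} (s : Finset ι) {c : ι → ℝ} {T : ι → Set R}
    (h : ∀ i ∈ s, Reach K S (c i) (T i)) : Reach K S (∑ i ∈ s, c i) (⋃ i ∈ s, T i) := by
  classical
  induction s using Finset.induction_on with
  | empty => exact .done (by simp) (by simp)
  | insert a s ha ih =>
    rw [Finset.sum_insert ha, Finset.set_biUnion_insert]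
    exact (h a (by simp)).union (ih fun i hi => h i (by simp [hi]))

theorem Reach.range {n : ℕ} {c : ℝ} {T : ℕ → Set R} (h : ∀ i < n, Reach K S c (T i)) :
    Reach K S (n * c) (⋃ i ∈ Finset.range n, T i) := by
  have := Reach.biUnion (Finset.range n) (c := fun _ => c) fun i hi => h i (Finset.mem_range.1 hi)
  simpa using this

theorem Reach.op {a b v : R} (ha : a ∈ avail K S) (hb : b ∈ avail K S) (h : IsOp a b v) :
    Reach K S 1 {v} :=
  ⟨1, by simp, .step ha hb h (.done (by simpa using subset_avail (Set.mem_insert _ _)))⟩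

theorem Reach.add {a b : R} (ha : a ∈ avail K S) (hb : b ∈ avail K S) : Reach K S 1 {a + b} :=
  .op ha hb (.inl rfl)

theorem Reach.sub {a b : R} (ha : a ∈ avail K S) (hb : b ∈ avail K S) : Reach K S 1 {a - b} :=
  .op ha hb (.inr (.inl rfl))

theorem Reach.mul {a b : R} (ha : a ∈ avail K S) (hb : b ∈ avail K S) : Reach K S 1 {a * b} :=
  .op ha hb (.inr (.inr (.inl rfl)))

theorem Reach.pow {a : R} (ha : a ∈ avail K S) (n : ℕ) :
    Reach K S n (⋃ i ∈ Finset.range (n + 1), {a ^ i}) := by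
  induction n with
  | zero => exact .done (by simp) (by simpa using one_mem_avail)
  | succ n ih =>
    refine ih.bind' (c' := 1) (by simp) fun S' hS hT => ?_
    have hn : a ^ n ∈ avail K S' := hT (by simp; exact ⟨n, by omega, rfl⟩)
    refine (Reach.mul hn (avail_mono hS ha)).bind' (c' := 0) (by simp) fun S'' hS' hT' => ?_
    refine .done le_rfl ?_
    rw [Finset.range_add_one, Finset.set_biUnion_insert, pow_succ]
    exact Set.union_subset hT' (hT.trans (avail_mono hS'))

end Reach

/-! ### Comparison with straight-line programs -/

section Programs

variable {K : Type*} [Field K] {D ι o : Type*}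

theorem mem_avail_of_value {S : Set (D → K)} {a : D → ι → K} {regs : List (D → K)}
    (ha : ∀ i, (fun x => a x i) ∈ S) (hr : ∀ v ∈ regs, v ∈ S) (q : Operand K ι) {w : D → K}
    (hD : Nonempty D) (hw : ∀ x, q.value (a x) (regs.map (· x)) = some (w x)) :
    w ∈ avail K S := by
  cases q with
  | input i =>
    have : w = fun x => a x i := funext fun x => by simpa [Operand.value] using (hw x).symm
    exact this ▸ subset_avail (ha i)
  | const c =>
    have : w = algebraMap K (D → K) c := funext fun x => by
      simpa [Operand.value] using (hw x).symm
    exact this ▸ const_mem_avail c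
  | reg n =>
    -- A register index out of range would be undefined at `x₀`; this is where a nonempty `D`
    -- matters.
    obtain ⟨x₀⟩ := hD
    have hn : n < regs.length := by
      by_contra hn
      have := hw x₀
      rw [Operand.value, List.getElem?_eq_none (by simpa using hn)] at this
      simp at this
    have : w = regs[n] := funext fun x => by
      have := hw x
      simp only [Operand.value, List.getElem?_map, List.getElem?_eq_getElem hn] at this
      simpa using this.symm
    exact this ▸ subset_avail (hr _ (List.getElem_mem hn))

/-- A quotient defined at every input has a nowhere vanishing denominator, which is a unit of the
function ring. -/
theorem isOp_of_apply {f : FieldOp} {a b v : D → K} (h : ∀ x, f.apply (a x) (b x) = some (v x)) :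
    IsOp a b v := by
  cases f with
  | add => exact .inl (funext fun x => by simpa [FieldOp.apply] using (h x).symm)
  | sub => exact .inr (.inl (funext fun x => by simpa [FieldOp.apply] using (h x).symm))
  | mul => exact .inr (.inr (.inl (funext fun x => by simpa [FieldOp.apply] using (h x).symm)))
  | div =>
    have h' : ∀ x, b x ≠ 0 ∧ a x / b x = v x := fun x => by
      have := h x
      simp only [FieldOp.apply] at this
      split_ifs at this with hb
      exact ⟨hb, by simpa using this⟩
    refine .inr (.inr (.inr ⟨?_, funext fun x => ?_⟩))
    · rw [Pi.isUnit_iff]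
      exact fun x => (h' x).1.isUnit
    · rw [Pi.mul_apply, ← (h' x).2, div_mul_cancel₀ _ (h' x).1]

theorem reachN_of_runCode {a : D → ι → K} (hD : Nonempty D) (out : o → Operand K ι)
    (y : D → o → K) : ∀ (code : List (Instr K ι)) (regs : List (D → K)) (S : Set (D → K)),
    (∀ i, (fun x => a x i) ∈ S) → (∀ v ∈ regs, v ∈ S) →
    (∀ x, ∃ fin, runCode (a x) code (regs.map (· x)) = some fin ∧
      ∀ k, (out k).value (a x) fin = some (y x k)) →
    ReachN K S code.length (Set.range fun k x => y x k)
  | [], regs, S, ha, hr, H => by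
    refine .done ?_
    rintro _ ⟨k, rfl⟩
    refine mem_avail_of_value ha hr (out k) hD fun x => ?_
    obtain ⟨fin, h, h'⟩ := H x
    simp only [runCode, Option.some.injEq] at h
    exact h ▸ h' k
  | s :: code, regs, S, ha, hr, H => by
    have key : ∀ x, ∃ u v w, s.left.value (a x) (regs.map (· x)) = some u ∧
        s.right.value (a x) (regs.map (· x)) = some v ∧ s.op.apply u v = some w ∧
        ∃ fin, runCode (a x) code (regs.map (· x) ++ [w]) = some fin ∧
          ∀ k, (out k).value (a x) fin = some (y x k) := fun x => by
      obtain ⟨fin, h, h'⟩ := H x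
      simp only [runCode, Instr.exec, Option.bind_eq_some_iff] at h
      obtain ⟨w, ⟨u, hu, v, hv, hw⟩, h⟩ := h
      exact ⟨u, v, w, hu, hv, hw, fin, h, h'⟩
    choose u v w hu hv hw hfin using key
    refine .step (mem_avail_of_value ha hr _ hD hu) (mem_avail_of_value ha hr _ hD hv)
      (isOp_of_apply hw) ?_
    refine reachN_of_runCode hD out y code (regs ++ [w]) _ (fun i => Or.inr (ha i)) ?_ ?_
    · intro z hz
      rcases List.mem_append.1 hz with hz | hz
      · exact Or.inr (hr z hz)
      · exact Or.inl (by simpa using hz)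
    · simpa using hfin

/-- A program computes in the ring of functions on a nonempty set `D`. -/
theorem reach_of_computes [Nonempty D] (P : SLP K ι o) {a : D → ι → K} {y : D → o → K}
    (h : ∀ x, P.Computes (a x) (y x)) :
    Reach K (Set.range fun i x => a x i) P.cost (Set.range fun k x => y x k) :=
  ⟨P.cost, le_rfl, reachN_of_runCode ‹_› P.out y P.code [] _ (fun i => ⟨i, rfl⟩) (by simp) h⟩

theorem exists_operand {S : Set (D → K)} {a : D → ι → K} {regs : List (D → K)}
    (hS : ∀ v ∈ S, (∃ i, v = fun x => a x i) ∨ v ∈ regs) {w : D → K} (hw : w ∈ avail K S) :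
    ∃ q : Operand K ι, ∀ x, q.value (a x) (regs.map (· x)) = some (w x) := by
  rcases hw with hw | ⟨c, rfl⟩
  · rcases hS w hw with ⟨i, rfl⟩ | hw
    · exact ⟨.input i, fun x => rfl⟩
    · obtain ⟨n, hn, rfl⟩ := List.getElem_of_mem hw
      exact ⟨.reg n, fun x => by simp [Operand.value, List.getElem?_eq_getElem hn]⟩
  · exact ⟨.const c, fun x => rfl⟩

theorem exists_fieldOp {a b v : D → K} (h : IsOp a b v) :
    ∃ f : FieldOp, ∀ x, f.apply (a x) (b x) = some (v x) := by
  rcases h with rfl | rfl | rfl | ⟨hb, rfl⟩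
  · exact ⟨.add, fun x => rfl⟩
  · exact ⟨.sub, fun x => rfl⟩
  · exact ⟨.mul, fun x => rfl⟩
  · refine ⟨.div, fun x => ?_⟩
    have := (Pi.isUnit_iff.1 hb x).ne_zero
    simp [FieldOp.apply, this]

/-- Each step is an identity between functions, so its instruction can be chosen before the input
and works at all points of `D` simultaneously. -/
theorem exists_program_of_reachN {a : D → ι → K} {y : D → o → K} {S T : Set (D → K)} {n : ℕ}
    (h : ReachN K S n T) : ∀ regs : List (D → K),
    (∀ v ∈ S, (∃ i, v = fun x => a x i) ∨ v ∈ regs) → (∀ k, (fun x => y x k) ∈ T) →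
    ∃ (code : List (Instr K ι)) (out : o → Operand K ι), code.length ≤ n ∧
      ∀ x, ∃ fin, runCode (a x) code (regs.map (· x)) = some fin ∧
        ∀ k, (out k).value (a x) fin = some (y x k) := by
  induction h with
  | done h =>
    intro regs hS hT
    choose out hout using fun k => exists_operand hS (h (hT k))
    exact ⟨[], out, by simp, fun x => ⟨_, rfl, fun k => hout k x⟩⟩
  | @step S n T u v w hu hv hw h ih =>
    intro regs hS hT
    obtain ⟨p, hp⟩ := exists_operand hS hu
    obtain ⟨q, hq⟩ := exists_operand hS hv
    obtain ⟨f, hf⟩ := exists_fieldOp hw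
    obtain ⟨code, out, hlen, H⟩ := ih (regs ++ [w]) (by
      rintro z (rfl | hz)
      · exact .inr (by simp)
      · rcases hS z hz with hz | hz
        · exact .inl hz
        · exact .inr (by simp [hz])) hT
    refine ⟨⟨f, p, q⟩ :: code, out, by simpa using hlen, fun x => ?_⟩
    obtain ⟨fin, h1, h2⟩ := H x
    refine ⟨fin, ?_, h2⟩
    simp only [List.map_append, List.map_cons, List.map_nil] at h1
    simpa [runCode, Instr.exec, hp x, hq x, hf x] using h1

/-- What can be reached in the ring of functions on `D` is computed by one program. -/
theorem exists_program_of_reach {a : D → ι → K} {y : D → o → K} {c : ℝ}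
    (h : Reach K (Set.range fun i x => a x i) c (Set.range fun k x => y x k)) :
    ∃ P : SLP K ι o, (P.cost : ℝ) ≤ c ∧ ∀ x, P.Computes (a x) (y x) := by
  obtain ⟨n, hn, h⟩ := h
  obtain ⟨code, out, hlen, H⟩ := exists_program_of_reachN h (a := a) (y := y) []
    (by rintro _ ⟨i, rfl⟩; exact .inl ⟨i, rfl⟩) (fun k => ⟨k, rfl⟩)
  exact ⟨⟨code, out⟩, le_trans (by simpa [SLP.cost] using hlen) hn, fun x => H x⟩

end Programs

/-- Execution is deterministic. Applied to the program that recovers the coefficients, this yields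
the uniqueness of L. -/
theorem computes_unique {K ι o : Type*} [Field K] {P : SLP K ι o} {x : ι → K} {y y' : o → K}
    (h : P.Computes x y) (h' : P.Computes x y') : y = y' := by
  obtain ⟨r, h1, h2⟩ := h
  obtain ⟨r', h1', h2'⟩ := h'
  obtain rfl : r = r' := by simpa [h1] using h1'
  exact funext fun k => by simpa [h2 k] using h2' k

/-! ### Polynomials given by their coefficients -/

section Coeffs

variable {R : Type*} [CommRing R]

/-- The set of coefficients of a polynomial. -/
def coeffs (f : R[X]) : Set R := Set.range f.coeff

theorem coeffs_subset {f : R[X]} {A : Set R} : coeffs f ⊆ A ↔ ∀ i, f.coeff i ∈ A :=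
  Set.range_subset_iff

/-- The polynomial `∑_{i < n} v_i X^i`. -/
noncomputable def polyOf (n : ℕ) (v : ℕ → R) : R[X] := ∑ i ∈ Finset.range n, monomial i (v i)

theorem coeff_polyOf (n : ℕ) (v : ℕ → R) (i : ℕ) :
    (polyOf n v).coeff i = if i < n then v i else 0 := by
  simp [polyOf, coeff_monomial]

theorem natDegree_polyOf_lt {n : ℕ} (hn : 0 < n) (v : ℕ → R) : (polyOf n v).natDegree < n := by
  have : (polyOf n v).natDegree ≤ n - 1 := natDegree_le_iff_coeff_eq_zero.2 fun i hi => by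
    rw [coeff_polyOf, if_neg (by omega)]
  omega

theorem coeff_eq_zero_of_lt {f : R[X]} {n i : ℕ} (hf : f.natDegree < n) (hi : n ≤ i) :
    f.coeff i = 0 :=
  coeff_eq_zero_of_natDegree_lt (hf.trans_le hi)

theorem natDegree_lt_of_coeff {f : R[X]} {n : ℕ} (hn : 0 < n) (h : ∀ i, n ≤ i → f.coeff i = 0) :
    f.natDegree < n := by
  have : f.natDegree ≤ n - 1 := natDegree_le_iff_coeff_eq_zero.2 fun i hi => h i (by omega)
  omega

theorem polyOf_coeff_self {f : R[X]} {n : ℕ} (hf : f.natDegree < n) : polyOf n f.coeff = f := by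
  ext i
  rw [coeff_polyOf]
  split_ifs with h
  · rfl
  · exact (coeff_eq_zero_of_lt hf (by omega)).symm

theorem X_pow_dvd_polyOf_coeff_sub (n : ℕ) (f : R[X]) : X ^ n ∣ polyOf n f.coeff - f :=
  X_pow_dvd_iff.2 fun i hi => by simp [coeff_polyOf, hi]

variable {K : Type*} [Field K] [Algebra K R] {S : Set R}

theorem coeffs_polyOf {n : ℕ} {v : ℕ → R} (h : ∀ i < n, v i ∈ avail K S) :
    coeffs (polyOf n v) ⊆ avail K S := coeffs_subset.2 fun i => by
  rw [coeff_polyOf]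
  split_ifs with hi
  · exact h i hi
  · exact zero_mem_avail

theorem coeffs_X_pow_mul {f : R[X]} (h : coeffs f ⊆ avail K S) (n : ℕ) :
    coeffs (X ^ n * f) ⊆ avail K S := coeffs_subset.2 fun i => by
  rw [coeff_X_pow_mul']
  split_ifs
  · exact coeffs_subset.1 h _
  · exact zero_mem_avail

theorem coeffs_X_pow (n : ℕ) : coeffs (X ^ n : R[X]) ⊆ avail K S := coeffs_subset.2 fun i => by
  rw [coeff_X_pow]
  split_ifs
  · exact one_mem_avail
  · exact zero_mem_avail

theorem Reach.coeffs_of_forall {f : R[X]} {n : ℕ} {c : ℝ} (hf : f.natDegree < n)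
    (h : ∀ i < n, Reach K S c {f.coeff i}) : Reach K S (n * c) (coeffs f) := by
  refine (Reach.range h).of_subset (coeffs_subset.2 fun i => ?_)
  by_cases hi : i < n
  · exact subset_avail (by simp; exact ⟨i, hi, rfl⟩)
  · rw [coeff_eq_zero_of_lt hf (by omega)]
    exact zero_mem_avail

theorem Reach.coeffs_add {f g : R[X]} {n : ℕ} (hf : f.natDegree < n) (hg : g.natDegree < n)
    (hfS : coeffs f ⊆ avail K S) (hgS : coeffs g ⊆ avail K S) :
    Reach K S n (coeffs (f + g)) := by
  have := Reach.coeffs_of_forall (K := K) (S := S) (f := f + g) (n := n) (c := 1)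
    ((natDegree_add_le _ _).trans_lt (max_lt hf hg)) fun i _ => by
      rw [coeff_add]
      exact .add (coeffs_subset.1 hfS i) (coeffs_subset.1 hgS i)
  simpa using this

theorem Reach.coeffs_sub {f g : R[X]} {n : ℕ} (hf : f.natDegree < n) (hg : g.natDegree < n)
    (hfS : coeffs f ⊆ avail K S) (hgS : coeffs g ⊆ avail K S) :
    Reach K S n (coeffs (f - g)) := by
  have := Reach.coeffs_of_forall (K := K) (S := S) (f := f - g) (n := n) (c := 1)
    ((natDegree_sub_le _ _).trans_lt (max_lt hf hg)) fun i _ => by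
      rw [coeff_sub]
      exact .sub (coeffs_subset.1 hfS i) (coeffs_subset.1 hgS i)
  simpa using this

/-- The elements `a_i b_i` for `i < n`, as coefficients of a polynomial. -/
theorem Reach.coeffs_polyOf_mul {n : ℕ} (hn : 0 < n) {a b : ℕ → R}
    (ha : ∀ i < n, a i ∈ avail K S) (hb : ∀ i < n, b i ∈ avail K S) :
    Reach K S n (coeffs (polyOf n fun i => a i * b i)) := by
  have := Reach.coeffs_of_forall (K := K) (S := S) (natDegree_polyOf_lt hn fun i => a i * b i) (c := 1)
    fun i hi => by
      rw [coeff_polyOf, if_pos hi]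
      exact .mul (ha i hi) (hb i hi)
  simpa using this

end Coeffs

/-! ### The cost of multiplication -/

section Mul

variable (K R : Type*) [Field K] [CommRing R] [Algebra K R]

/-- Two polynomials of degree less than `n` can be multiplied within `c` operations. -/
def MulCost (n : ℕ) (c : ℝ) : Prop :=
  ∀ f g : R[X], f.natDegree < n → g.natDegree < n → Reach K (coeffs f ∪ coeffs g) c (coeffs (f * g))

/-- For `n ≤ N` two polynomials of degree less than `n` can be multiplied within `μ n`
operations. -/
def MulBound (μ : ℝ) (N : ℕ) : Prop := 1 ≤ μ ∧ ∀ n ≤ N, MulCost K R n (μ * n)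

variable {K R} {S : Set R}

theorem MulCost.reach {n : ℕ} {c : ℝ} (h : MulCost K R n c) {f g : R[X]} (hf : f.natDegree < n)
    (hg : g.natDegree < n) (hfS : coeffs f ⊆ avail K S) (hgS : coeffs g ⊆ avail K S) :
    Reach K S c (coeffs (f * g)) :=
  (h f g hf hg).mono (Set.union_subset hfS hgS) le_rfl

theorem MulBound.reach {μ : ℝ} {N : ℕ} (h : MulBound K R μ N) {n : ℕ} (hn : n ≤ N) {f g : R[X]}
    (hf : f.natDegree < n) (hg : g.natDegree < n) (hfS : coeffs f ⊆ avail K S)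
    (hgS : coeffs g ⊆ avail K S) : Reach K S (μ * n) (coeffs (f * g)) :=
  (h.2 n hn).reach hf hg hfS hgS

/-- Schoolbook splitting into halves: four products, one addition of length 2h and two of length 4h.
-/
theorem MulCost.double {h : ℕ} (hh : 0 < h) {c : ℝ} (H : MulCost K R h c) :
    MulCost K R (2 * h) (4 * c + 10 * h) := by
  intro f g hf hg
  set S := coeffs f ∪ coeffs g
  have split : ∀ p : R[X], p.natDegree < 2 * h →
      p = polyOf h p.coeff + X ^ h * polyOf h (fun i => p.coeff (i + h)) := fun p hp => by
    ext i
    rw [coeff_add, coeff_X_pow_mul', coeff_polyOf, coeff_polyOf]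
    by_cases hi : i < h
    · simp [hi, show ¬ h ≤ i by omega]
    · by_cases hi' : i < 2 * h
      · simp [hi, show h ≤ i by omega, show i - h < h by omega]
      · simp [hi, show h ≤ i by omega, show ¬ i - h < h by omega,
          coeff_eq_zero_of_lt hp (by omega : 2 * h ≤ i)]
  obtain ⟨f₀, f₁, hf₀, hf₁, rfl, hfS₀, hfS₁⟩ : ∃ f₀ f₁ : R[X], f₀.natDegree < h ∧
      f₁.natDegree < h ∧ f = f₀ + X ^ h * f₁ ∧ coeffs f₀ ⊆ avail K S ∧ coeffs f₁ ⊆ avail K S :=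
    ⟨_, _, natDegree_polyOf_lt hh _, natDegree_polyOf_lt hh _, split f hf,
      coeffs_polyOf fun i _ => subset_avail (.inl ⟨i, rfl⟩),
      coeffs_polyOf fun i _ => subset_avail (.inl ⟨i + h, rfl⟩)⟩
  obtain ⟨g₀, g₁, hg₀, hg₁, rfl, hgS₀, hgS₁⟩ : ∃ g₀ g₁ : R[X], g₀.natDegree < h ∧
      g₁.natDegree < h ∧ g = g₀ + X ^ h * g₁ ∧ coeffs g₀ ⊆ avail K S ∧ coeffs g₁ ⊆ avail K S :=
    ⟨_, _, natDegree_polyOf_lt hh _, natDegree_polyOf_lt hh _, split g hg,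
      coeffs_polyOf fun i _ => subset_avail (.inr ⟨i, rfl⟩),
      coeffs_polyOf fun i _ => subset_avail (.inr ⟨i + h, rfl⟩)⟩
  have deg : ∀ p q : R[X], p.natDegree < h → q.natDegree < h → (p * q).natDegree < 2 * h :=
    fun p q hp hq => natDegree_mul_le.trans_lt (by omega)
  have degX : ∀ (p : R[X]) (k m : ℕ), p.natDegree < m → (X ^ k * p).natDegree < k + m :=
    fun p k m hp => natDegree_mul_le.trans_lt (by have := natDegree_X_pow_le (R := R) k; omega)
  have dega : ∀ (p q : R[X]) (m : ℕ), p.natDegree < m → q.natDegree < m →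
      (p + q).natDegree < m := fun p q m hp hq => (natDegree_add_le _ _).trans_lt (max_lt hp hq)
  have heq : (f₀ + X ^ h * f₁) * (g₀ + X ^ h * g₁) =
      (f₀ * g₀ + X ^ h * (f₀ * g₁ + f₁ * g₀)) + X ^ (2 * h) * (f₁ * g₁) := by ring
  rw [heq]
  refine (((H.reach hf₀ hg₀ hfS₀ hgS₀).union (H.reach hf₀ hg₁ hfS₀ hgS₁)).union
    ((H.reach hf₁ hg₀ hfS₁ hgS₀).union (H.reach hf₁ hg₁ hfS₁ hgS₁))).bind'
    (c' := 10 * h) (by linarith) fun S' _ hT => ?_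
  simp only [Set.union_subset_iff] at hT
  obtain ⟨⟨h00, h01⟩, h10, h11⟩ := hT
  refine (Reach.coeffs_add (deg _ _ hf₀ hg₁) (deg _ _ hf₁ hg₀) h01 h10).bind'
    (c' := 8 * h) (by push_cast; linarith) fun S₂ hS₂ hT₂ => ?_
  refine (Reach.coeffs_add (n := 4 * h) ((deg _ _ hf₀ hg₀).trans_le (by omega))
    ((degX _ h (2 * h) (dega _ _ _ (deg _ _ hf₀ hg₁) (deg _ _ hf₁ hg₀))).trans_le (by omega))
    (h00.trans (avail_mono hS₂)) (coeffs_X_pow_mul hT₂ h)).bind'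
    (c' := 4 * h) (by push_cast; linarith) fun S₃ hS₃ hT₃ => ?_
  refine (Reach.coeffs_add (n := 4 * h) (dega _ _ _ ((deg _ _ hf₀ hg₀).trans_le (by omega))
      ((degX _ h (2 * h) (dega _ _ _ (deg _ _ hf₀ hg₁) (deg _ _ hf₁ hg₀))).trans_le (by omega)))
    ((degX _ (2 * h) (2 * h) (deg _ _ hf₁ hg₁)).trans_le (by omega)) hT₃
    (coeffs_X_pow_mul (h11.trans (avail_mono (hS₂.trans hS₃))) (2 * h))).le (by push_cast; linarith)

theorem MulCost.mono {n n' : ℕ} {c c' : ℝ} (h : MulCost K R n c) (hn : n' ≤ n) (hc : c ≤ c') :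
    MulCost K R n' c' :=
  fun f g hf hg => (h f g (hf.trans_le hn) (hg.trans_le hn)).le hc

theorem MulBound.double {μ : ℝ} {N : ℕ} (h : MulBound K R μ N) :
    MulBound K R (14 * μ) (2 * N) := by
  refine ⟨by linarith [h.1], fun n hn => ?_⟩
  rcases Nat.eq_zero_or_pos n with rfl | hn0
  · intro f g hf
    exact absurd hf (by omega)
  · have hle : (n + 1) / 2 ≤ n := by omega
    -- With h = ⌈n/2⌉ the cost 4μh + 10h is at most 14μh, and h ≤ n suffices.
    refine ((h.2 ((n + 1) / 2) (by omega)).double (by omega)).mono (by omega) ?_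
    have h1 : (((n + 1) / 2 : ℕ) : ℝ) ≤ n := by exact_mod_cast hle
    have h0 : (0 : ℝ) ≤ n := n.cast_nonneg
    nlinarith [h.1, mul_le_mul_of_nonneg_left h1 (by linarith [h.1] : (0 : ℝ) ≤ μ),
      mul_le_mul_of_nonneg_right h.1 h0]

/-- A program without instructions can only output an input or a constant, and ab is neither. The
bound gives μ ≥ 1, so that linear-time overheads are absorbed by multiplications. -/
theorem one_le_of_isMulTime {M : ℕ → ℝ} [CharZero K] (hM : IsMulTime K M) : 1 ≤ M 1 := by
  obtain ⟨P, hP, H⟩ := hM.1 1 le_rfl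
  refine le_trans ?_ hP
  rw [Nat.one_le_cast, Nat.one_le_iff_ne_zero]
  intro h0
  have hcode : P.code = [] := List.eq_nil_of_length_eq_zero h0
  have key : ∀ a b : K, (P.out 0).value (Sum.elim (fun _ : Fin 1 => a) fun _ : Fin 1 => b) [] =
      some (a * b) := fun a b => by
    obtain ⟨regs, h1, h2⟩ := H (fun _ => a) fun _ => b
    rw [hcode] at h1
    simp only [runCode, Option.some.injEq] at h1
    rw [h1, h2 0]
    simp [polyOfCoeffs]
  cases hq : P.out 0 with
  | input i =>
    rcases i with i | i
    · have := key 1 2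
      simp [hq, Operand.value] at this
    · have := key 2 1
      simp [hq, Operand.value] at this
  | const c =>
    have h1 := key 1 1
    have h2 := key 1 2
    simp only [hq, Operand.value, Option.some.injEq] at h1 h2
    rw [h1] at h2
    norm_num at h2
  | reg n =>
    have := key 1 1
    simp [hq, Operand.value] at this

theorem mulCost_of_isMulTime {M : ℕ → ℝ} (hM : IsMulTime K M) {D : Type*} [Nonempty D] {n : ℕ}
    (hn : 1 ≤ n) : MulCost K (D → K) n (M n) := by
  intro f g hf hg
  obtain ⟨P, hP, H⟩ := hM.1 n hn
  have hpoly : ∀ p : (D → K)[X], p.natDegree < n → ∀ x : D,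
      p.map (Pi.evalRingHom _ x) = polyOfCoeffs fun i : Fin n => p.coeff i x := fun p hp x => by
    ext i
    rw [coeff_map, polyOfCoeffs, finsetSum_coeff]
    simp only [coeff_monomial, Pi.evalRingHom_apply]
    by_cases hi : i < n
    · rw [Finset.sum_eq_single ⟨i, hi⟩] <;> simp +contextual [Fin.ext_iff]
    · rw [coeff_eq_zero_of_lt hp (by omega), Finset.sum_eq_zero]
      · rfl
      · intro j _
        rw [if_neg (by omega)]
  have := reach_of_computes P (a := fun x => Sum.elim (fun i : Fin n => f.coeff i x)
    fun i : Fin n => g.coeff i x) fun x => H _ _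
  refine ((this.le hP).mono ?_ le_rfl).of_subset (coeffs_subset.2 fun k => ?_)
  · rintro _ ⟨i | i, rfl⟩
    · exact subset_avail (.inl ⟨i, rfl⟩)
    · exact subset_avail (.inr ⟨i, rfl⟩)
  · by_cases hk : k < 2 * n - 1
    · refine subset_avail ⟨⟨k, hk⟩, funext fun x => ?_⟩
      change ((polyOfCoeffs fun i : Fin n => f.coeff i x) *
        polyOfCoeffs fun i : Fin n => g.coeff i x).coeff k = _
      rw [← hpoly f hf, ← hpoly g hg, ← Polynomial.map_mul, coeff_map]
      rfl
    · rw [coeff_eq_zero_of_natDegree_lt (natDegree_mul_le.trans_lt (by omega))]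
      exact zero_mem_avail

/-- Monotonicity of M(n)/n gives the rate M(r)/r up to size r; two doublings give 196 = 14² and size
4r. Interpolation needs this room, as it handles sizes up to 2pd + 1 with pd < 2r. -/
theorem mulBound_of_isMulTime {M : ℕ → ℝ} [CharZero K] (hM : IsMulTime K M) {D : Type*}
    [Nonempty D] {r : ℕ} (hr : 1 ≤ r) : MulBound K (D → K) (196 * (M r / r)) (4 * r) := by
  have key : MulBound K (D → K) (M r / r) r := by
    refine ⟨?_, fun n hn => ?_⟩
    · have := hM.2 (Set.mem_Ici.2 le_rfl) (Set.mem_Ici.2 hr) hr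
      simp only [Nat.cast_one, div_one] at this
      exact (one_le_of_isMulTime hM).trans this
    · rcases Nat.eq_zero_or_pos n with rfl | hn0
      · intro f g hf
        exact absurd hf (by omega)
      · refine (mulCost_of_isMulTime hM hn0).mono le_rfl ?_
        have := hM.2 (Set.mem_Ici.2 hn0) (Set.mem_Ici.2 hr) hn
        rwa [div_le_iff₀ (by exact_mod_cast hn0)] at this
  have := key.double.double
  rwa [← mul_assoc, ← mul_assoc, show (14 : ℝ) * 14 = 196 by norm_num,
    show 2 * 2 = 4 by norm_num] at this

end Mul

/-! ### Taylor shifts and inverses of power series -/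

section Shift

variable {K R : Type*} [Field K] [CommRing R] [Algebra K R] {S : Set R} {μ : ℝ} {N : ℕ}

theorem coeff_taylor_eq_sum {f : R[X]} {n : ℕ} (hf : f.natDegree < n) (α : R) (j : ℕ) :
    (taylor α f).coeff j =
      ∑ i ∈ Finset.range n, f.coeff i * (α ^ (i - j) * (i.choose j : ℕ)) := by
  conv_lhs => rw [← polyOf_coeff_self hf]
  rw [polyOf, map_sum, finsetSum_coeff]
  exact Finset.sum_congr rfl fun i _ => by rw [taylor_monomial, coeff_C_mul, coeff_X_add_C_pow]

theorem coeff_mul_eq_sum_range (f g : R[X]) (n : ℕ) :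
    (f * g).coeff n = ∑ i ∈ Finset.range (n + 1), f.coeff i * g.coeff (n - i) := by
  rw [coeff_mul, Finset.Nat.sum_antidiagonal_eq_sum_range_succ_mk]

/-- By i.choose j = i!/(j!(i-j)!), the sum ∑ f_i (i.choose j) α^{i-j} is a correlation of i! f_i
with α^b/b!. Reversing the first sequence makes it a convolution, hence one product. -/
theorem taylor_eq_polyOf [CharZero K] {f : R[X]} {n : ℕ} (hf : f.natDegree < n) (α : R) :
    taylor α f = polyOf n fun j => algebraMap K R ((j.factorial : K)⁻¹) *
      (polyOf n (fun a => algebraMap K R ((n - 1 - a).factorial : K) * f.coeff (n - 1 - a)) *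
        polyOf n (fun b => algebraMap K R ((b.factorial : K)⁻¹) * α ^ b)).coeff (n - 1 - j) := by
  ext j
  rw [coeff_polyOf]
  split_ifs with hj
  · rw [coeff_taylor_eq_sum hf, coeff_mul_eq_sum_range, Finset.mul_sum]
    have hsub : (Finset.range n).filter (j ≤ ·) ⊆ Finset.range n := Finset.filter_subset _ _
    rw [← Finset.sum_subset hsub fun i _ hi' => ?_]
    · refine Finset.sum_nbij' (fun i => n - 1 - i) (fun a => n - 1 - a) ?_ ?_ ?_ ?_ ?_
      · intro i hi
        simp only [Finset.mem_filter, Finset.mem_range] at hi ⊢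
        omega
      · intro i hi
        simp only [Finset.mem_filter, Finset.mem_range] at hi ⊢
        omega
      · intro i hi
        simp only [Finset.mem_filter, Finset.mem_range] at hi
        omega
      · intro i hi
        simp only [Finset.mem_range] at hi
        omega
      · intro i hi
        simp only [Finset.mem_filter, Finset.mem_range] at hi
        rw [coeff_polyOf, if_pos (by omega), coeff_polyOf, if_pos (by omega),
          show n - 1 - (n - 1 - i) = i by omega, show n - 1 - j - (n - 1 - i) = i - j by omega,
          ← map_natCast (algebraMap K R), Nat.cast_choose K hi.2]
        have h1 : (j.factorial : K)⁻¹ * (i.factorial : K) * ((i - j).factorial : K)⁻¹ =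
            i.factorial / (j.factorial * (i - j).factorial) := by
          rw [div_eq_mul_inv, mul_inv]
          ring
        rw [← h1, map_mul, map_mul]
        ring
    · rw [Nat.choose_eq_zero_of_lt (by simp_all), Nat.cast_zero, mul_zero, mul_zero]
  · exact coeff_eq_zero_of_natDegree_lt (by rw [natDegree_taylor]; omega)

theorem MulBound.reach_taylor [CharZero K] (hμ : MulBound K R μ N) {n : ℕ} (hn : 0 < n) (hN : n ≤ N)
    {f : R[X]} (hf : f.natDegree < n) {α : R} (hα : α ∈ avail K S) (hfS : coeffs f ⊆ avail K S) :
    Reach K S (5 * μ * n) (coeffs (taylor α f)) := by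
  rw [taylor_eq_polyOf (K := K) hf α]
  set F := polyOf n fun a => algebraMap K R ((n - 1 - a).factorial : K) * f.coeff (n - 1 - a)
  set E := polyOf n fun b => algebraMap K R ((b.factorial : K)⁻¹) * α ^ b
  have hc : 4 * (n : ℝ) + μ * n ≤ 5 * μ * n := by
    nlinarith [mul_le_mul_of_nonneg_right hμ.1 (n.cast_nonneg : (0 : ℝ) ≤ n)]
  -- Besides one product, n operations each go to the powers of α, to `E`, to `F` and to the final
  -- scaling.
  refine (Reach.pow hα n).bind' (c' := 3 * n + μ * n) (by linarith) fun S₁ h₁ hT₁ => ?_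
  refine (Reach.coeffs_polyOf_mul (S := S₁) hn (fun i _ => const_mem_avail _) fun i hi =>
    hT₁ ?_).bind' (T := coeffs E) (c' := 2 * n + μ * n) (by linarith) fun S₂ h₂ hT₂ => ?_
  · simp only [Set.mem_iUnion, Finset.mem_range]
    exact ⟨i, by omega, rfl⟩
  refine (Reach.coeffs_polyOf_mul (S := S₂) hn (fun i _ => const_mem_avail _) fun i hi =>
    avail_mono (h₁.trans h₂) (coeffs_subset.1 hfS _)).bind' (T := coeffs F)
    (c' := n + μ * n) (by linarith) fun S₃ h₃ hT₃ => ?_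
  refine (hμ.reach hN (natDegree_polyOf_lt hn _) (natDegree_polyOf_lt hn _) hT₃
    (hT₂.trans (avail_mono h₃))).bind' (c' := n) (by linarith) fun S₄ _ hT₄ => ?_
  exact Reach.coeffs_polyOf_mul hn (fun i _ => const_mem_avail _) fun i _ =>
    coeffs_subset.1 hT₄ _

/-- The Newton step g ↦ g(2 - fg) squares the error 1 - fg. Every step runs at full precision n; the
resulting logarithmic factor is affordable. -/
theorem MulBound.newton (hμ : MulBound K R μ N) {n : ℕ} (hn : 0 < n) (hN : n ≤ N)
    {f : R[X]} (hf : f.natDegree < n) (h0 : IsUnit (f.coeff 0)) (hfS : coeffs f ⊆ avail K S)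
    (k : ℕ) : ∃ g : R[X], g.natDegree < n ∧ X ^ min n (2 ^ k) ∣ f * g - 1 ∧
      Reach K S (1 + 3 * μ * n * k) (coeffs g) := by
  induction k with
  | zero =>
    obtain ⟨u, hu⟩ := h0
    refine ⟨C (↑u⁻¹ : R), by simpa using hn, ?_, ?_⟩
    · have : min n (2 ^ 0) = 1 := by simp; omega
      rw [this, X_pow_dvd_iff]
      intro d hd
      obtain rfl : d = 0 := by omega
      simp [← hu]
    · refine (Reach.op (a := 1) (v := (↑u⁻¹ : R)) one_mem_avail (coeffs_subset.1 hfS 0)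
        (.inr (.inr (.inr ⟨⟨u, hu⟩, by simp [← hu]⟩)))).le (by simp) |>.of_subset ?_
      refine coeffs_subset.2 fun i => ?_
      rw [coeff_C]
      split_ifs
      · exact subset_avail rfl
      · exact zero_mem_avail
  | succ k ih =>
    obtain ⟨g, hg, hdvd, hreach⟩ := ih
    set q := polyOf n (f * g).coeff with hq
    set g' := polyOf n (g * (2 - q)).coeff with hg'
    refine ⟨g', natDegree_polyOf_lt hn _, ?_, ?_⟩
    · have hq' : X ^ n ∣ q - f * g := X_pow_dvd_polyOf_coeff_sub n _
      have hg'' : X ^ n ∣ g' - g * (2 - q) := X_pow_dvd_polyOf_coeff_sub n _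
      have heq : f * g' - 1 =
          f * (g' - g * (2 - q)) - f * g * (q - f * g) - (f * g - 1) ^ 2 := by ring
      rw [heq]
      have hmin : min n (2 ^ (k + 1)) ≤ n := min_le_left _ _
      refine dvd_sub (dvd_sub (((pow_dvd_pow X hmin).trans hg'').mul_left _)
        (((pow_dvd_pow X hmin).trans hq').mul_left _)) ?_
      have hsq : X ^ (min n (2 ^ k) * 2) ∣ (f * g - 1) ^ 2 := by
        rw [pow_mul]
        exact pow_dvd_pow_of_dvd hdvd 2
      refine (pow_dvd_pow (X : R[X]) ?_).trans hsq
      rw [pow_succ]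
      omega
    · have hn1 : (n : ℝ) ≤ μ * n := by
        nlinarith [mul_le_mul_of_nonneg_right hμ.1 (n.cast_nonneg : (0 : ℝ) ≤ n)]
      refine hreach.bind' (c' := 3 * μ * n) (by push_cast; linarith) fun S₁ h₁ hT₁ => ?_
      refine (hμ.reach hN hf hg (hfS.trans (avail_mono h₁)) hT₁).bind' (c' := 2 * μ * n)
        (by linarith) fun S₂ h₂ hT₂ => ?_
      have hqd : q.natDegree < n := natDegree_polyOf_lt hn _
      refine (Reach.coeffs_sub (n := n) (f := (2 : R[X])) (g := q) (S := S₂) ?_ hqd ?_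
        (coeffs_polyOf fun i _ => coeffs_subset.1 hT₂ i)).bind' (c' := μ * n) (by linarith)
        fun S₃ h₃ hT₃ => ?_
      · rw [natDegree_ofNat]
        exact hn
      · refine coeffs_subset.2 fun i => ?_
        rw [show (2 : R[X]) = C (algebraMap K R 2) by rw [map_ofNat, map_ofNat], coeff_C]
        split_ifs
        · exact const_mem_avail _
        · exact zero_mem_avail
      · refine (hμ.reach hN hg ((natDegree_sub_le _ _).trans_lt (max_lt ?_ hqd))
          (hT₁.trans (avail_mono (h₂.trans h₃))) hT₃).of_subset
          (coeffs_polyOf fun i _ => subset_avail ⟨i, rfl⟩)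
        rw [natDegree_ofNat]
        exact hn

/-- Inversion of power series. -/
theorem MulBound.inverse (hμ : MulBound K R μ N) {n : ℕ} (hn : 0 < n) (hN : n ≤ N)
    {f : R[X]} (h0 : IsUnit (f.coeff 0)) (hfS : ∀ i < n, f.coeff i ∈ avail K S) :
    ∃ g : R[X], g.natDegree < n ∧ X ^ n ∣ f * g - 1 ∧
      Reach K S (3 * μ * n * (Nat.clog 2 n + 1)) (coeffs g) := by
  obtain ⟨g, hg, hdvd, hreach⟩ := hμ.newton hn hN (natDegree_polyOf_lt hn f.coeff)
    (by rwa [coeff_polyOf, if_pos hn]) (coeffs_polyOf hfS) (Nat.clog 2 n)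
  refine ⟨g, hg, ?_, hreach.le ?_⟩
  · rw [min_eq_left (Nat.le_pow_clog (by norm_num) n)] at hdvd
    have := dvd_sub hdvd ((X_pow_dvd_polyOf_coeff_sub n f).mul_right g)
    rwa [show polyOf n f.coeff * g - 1 - (polyOf n f.coeff - f) * g = f * g - 1 by ring] at this
  · have hn1 : (1 : ℝ) ≤ n := by exact_mod_cast hn
    nlinarith [mul_le_mul hμ.1 hn1 zero_le_one (zero_le_one.trans hμ.1)]

end Shift

/-! ### Scaled remainder trees -/

section Scaled

variable {R : Type*} [CommRing R]

/-- `s` is the polynomial part of `X ^ a * g / A`, where `g` is the remainder of `f` modulo the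
polynomial `A` of degree `a`. -/
def IsScaledRem (a : ℕ) (f A s : R[X]) : Prop :=
  s.natDegree < a ∧ ∃ q e : R[X], e.natDegree < a ∧ X ^ a * f = X ^ a * q * A + s * A + e

/-- Bounds by vanishing coefficients, unlike bounds on `natDegree`, allow the value 0 for the zero
polynomial, which occurs below for empty low parts. -/
theorem coeff_mul_eq_zero {p q : R[X]} {a b j : ℕ} (hp : ∀ i, a ≤ i → p.coeff i = 0)
    (hq : ∀ i, b ≤ i → q.coeff i = 0) (h : a + b ≤ j + 1) : (p * q).coeff j = 0 := by
  rw [coeff_mul]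
  refine Finset.sum_eq_zero fun x hx => ?_
  have := Finset.HasAntidiagonal.mem_antidiagonal.1 hx
  rcases le_or_gt a x.1 with h' | h'
  · rw [hp _ h', zero_mul]
  · rw [hq _ (by omega), mul_zero]

/-- Here s holds a + b digits of the fractional part of f/(AB). In sB, an approximation of f/A, the
top digits belong to the polynomial part and the b lowest are inexact; the a digits between are
those wanted for A. Going down the tree thus takes multiplications only. -/
theorem IsScaledRem.of_mul {a b : ℕ} (ha : 0 < a) {f A B s : R[X]}
    (hA : A.natDegree ≤ a) (hB : B.natDegree ≤ b) (h : IsScaledRem (a + b) f (A * B) s) :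
    IsScaledRem a f A (polyOf a fun i => (s * B).coeff (i + b)) := by
  obtain ⟨hs, q, e, he, heq⟩ := h
  refine ⟨natDegree_polyOf_lt ha _, ?_⟩
  set mid := polyOf a fun i => (s * B).coeff (i + b)
  set low := polyOf b (s * B).coeff with hlow
  set high := polyOf b fun i => (s * B).coeff (i + (a + b))
  have hT : s * B = low + X ^ b * mid + X ^ (a + b) * high := by
    ext i
    rw [coeff_add, coeff_add, coeff_X_pow_mul', coeff_X_pow_mul', coeff_polyOf, coeff_polyOf,
      coeff_polyOf]
    by_cases h1 : i < b
    · simp [h1, show ¬ b ≤ i by omega, show ¬ a + b ≤ i by omega]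
    · by_cases h2 : i < a + b
      · simp [h1, show b ≤ i by omega, show ¬ a + b ≤ i by omega, show i - b < a by omega]
      · by_cases h3 : i < a + b + b
        · simp [h1, show b ≤ i by omega, show a + b ≤ i by omega, show ¬ i - b < a by omega,
            show i - (a + b) < b by omega]
        · rw [coeff_eq_zero_of_natDegree_lt (natDegree_mul_le.trans_lt (by omega))]
          simp [h1, show b ≤ i by omega, show a + b ≤ i by omega, show ¬ i - b < a by omega,
            show ¬ i - (a + b) < b by omega]
  -- The right side has degree below a + b, so the new error term has degree below a.
  have hdvd : X ^ b * (X ^ a * f - X ^ a * (q * B + high) * A - mid * A) = low * A + e := by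
    rw [pow_add] at heq hT
    linear_combination heq + A * hT
  refine ⟨q * B + high, X ^ a * f - X ^ a * (q * B + high) * A - mid * A, ?_, by ring⟩
  refine natDegree_lt_of_coeff ha fun i hi => ?_
  rw [← coeff_X_pow_mul _ b, hdvd, coeff_add, coeff_eq_zero_of_lt he (by omega),
    coeff_mul_eq_zero (a := b) (b := a + 1) (fun j hj => by rw [hlow, coeff_polyOf, if_neg (by omega)])
      (fun j hj => coeff_eq_zero_of_natDegree_lt (by omega)) (by omega), add_zero]

/-- At a leaf, X^a (f - qA) = sA + e with deg e < a, so the remainder is the upper part of sA. -/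
theorem IsScaledRem.eq_mul_add {a : ℕ} {f A s : R[X]} (hA : A.natDegree ≤ a)
    (h : IsScaledRem a f A s) :
    ∃ q, f = q * A + polyOf a fun i => (s * A).coeff (i + a) := by
  obtain ⟨hs, q, e, he, heq⟩ := h
  refine ⟨q, ?_⟩
  have key : ∀ i, (f - q * A).coeff i = (s * A).coeff (i + a) := fun i => by
    have h1 : X ^ a * (f - q * A) = s * A + e := by linear_combination heq
    rw [← coeff_X_pow_mul _ a, h1, coeff_add, coeff_eq_zero_of_lt he (by omega), add_zero]
  rw [← sub_eq_iff_eq_add']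
  ext i
  rw [key, coeff_polyOf]
  split_ifs with hi
  · rfl
  · exact coeff_eq_zero_of_natDegree_lt (natDegree_mul_le.trans_lt (by omega))

/-- The root of the tree: the reversed inverse G of the reversal of P satisfies PG = X^{2n-1} +
(terms of degree below n), so G/X^{2n-1} approximates 1/P well enough to read off the n digits of
f/P. -/
theorem isScaledRem_of_inverse {n : ℕ} (hn : 0 < n) {f P g : R[X]} (hP : P.natDegree ≤ n)
    (hf : f.natDegree < n) (hg : g.natDegree < n) (h : X ^ n ∣ reflect n P * g - 1) :
    IsScaledRem n f P (polyOf n fun i => (f * reflect (n - 1) g).coeff (i + (n - 1))) := by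
  refine ⟨natDegree_polyOf_lt hn _, 0, ?_⟩
  set s := polyOf n fun i => (f * reflect (n - 1) g).coeff (i + (n - 1)) with hs
  set G := reflect (n - 1) g with hG
  have hGc : ∀ i, n ≤ i → G.coeff i = 0 := fun i hi => by
    rw [hG, coeff_reflect, revAt_eq_self_of_lt (by omega), coeff_eq_zero_of_lt hg hi]
  have hfc : ∀ i, n ≤ i → f.coeff i = 0 := fun i hi => coeff_eq_zero_of_lt hf hi
  have hPc : ∀ i, n + 1 ≤ i → P.coeff i = 0 := fun i hi =>
    coeff_eq_zero_of_natDegree_lt (by omega)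
  have hPG : P * G = reflect (n + (n - 1)) (reflect n P * g) := by
    rw [reflect_mul _ _ _ (by omega), reflect_reflect]
    refine natDegree_le_iff_coeff_eq_zero.2 fun i hi => ?_
    rw [coeff_reflect, revAt_eq_self_of_lt hi]
    exact hPc i hi
  have hE : ∀ i, n ≤ i → (P * G - X ^ (n + (n - 1))).coeff i = 0 := fun i hi => by
    rw [coeff_sub, coeff_X_pow]
    rcases le_or_gt i (n + (n - 1)) with hi' | hi'
    · have h1 := X_pow_dvd_iff.1 h (n + (n - 1) - i) (by omega)
      rw [coeff_sub, sub_eq_zero] at h1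
      rw [hPG, coeff_reflect, revAt_le hi', h1, coeff_one, sub_eq_zero]
      congr 1
      simp only [eq_iff_iff]
      omega
    · rw [coeff_mul_eq_zero hPc hGc (by omega), if_neg (by omega), sub_zero]
  have hlow : ∀ i, n - 1 ≤ i → (f * G - X ^ (n - 1) * s).coeff i = 0 := fun i hi => by
    rw [coeff_sub, coeff_X_pow_mul', if_pos hi, hs, coeff_polyOf, show i - (n - 1) + (n - 1) = i by omega]
    split_ifs with h'
    · exact sub_self _
    · rw [sub_zero, coeff_mul_eq_zero hfc hGc (by omega)]
  refine ⟨X ^ n * f - s * P, natDegree_lt_of_coeff hn fun i hi => ?_, by ring⟩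
  have heq : X ^ (n - 1) * (X ^ n * f - s * P) =
      (f * G - X ^ (n - 1) * s) * P - f * (P * G - X ^ (n + (n - 1))) := by ring
  rw [← coeff_X_pow_mul _ (n - 1), heq, coeff_sub, coeff_mul_eq_zero hlow hPc (by omega),
    coeff_mul_eq_zero hfc hE (by omega), sub_zero]

end Scaled

/-! ### Subproduct trees: products, reduction to the leaves, recombination. -/

section Tree

variable {K R : Type*} [Field K] [CommRing R] [Algebra K R] {S : Set R} {μ : ℝ} {N : ℕ}

/-- The product of the `A_k` with `a ≤ k < a + m`. -/
noncomputable def intervalProd (A : ℕ → R[X]) (a m : ℕ) : R[X] := ∏ k ∈ Finset.Ico a (a + m), A k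

theorem intervalProd_add (A : ℕ → R[X]) (a h m : ℕ) :
    intervalProd A a (h + m) = intervalProd A a h * intervalProd A (a + h) m := by
  rw [intervalProd, intervalProd, intervalProd, ← add_assoc,
    Finset.prod_Ico_consecutive _ (by omega) (by omega)]

theorem intervalProd_one (A : ℕ → R[X]) (a : ℕ) : intervalProd A a 1 = A a := by
  simp [intervalProd]

theorem natDegree_intervalProd_le {A : ℕ → R[X]} {a m d : ℕ}
    (h : ∀ k, a ≤ k → k < a + m → (A k).natDegree ≤ d) :
    (intervalProd A a m).natDegree ≤ m * d := by
  refine (natDegree_prod_le _ _).trans ((Finset.sum_le_card_nsmul _ _ d fun k hk => ?_).trans ?_)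
  · exact h k (Finset.mem_Ico.1 hk).1 (Finset.mem_Ico.1 hk).2
  · simp

/-- The sum of the `N_k ∏_{j ≠ k} A_j` for `a ≤ k < a + m`. -/
noncomputable def intervalSum (A B : ℕ → R[X]) (a m : ℕ) : R[X] :=
  ∑ k ∈ Finset.Ico a (a + m), B k * intervalProd (Function.update A k 1) a m

theorem intervalProd_congr {A A' : ℕ → R[X]} {a m : ℕ}
    (h : ∀ k, a ≤ k → k < a + m → A k = A' k) : intervalProd A a m = intervalProd A' a m :=
  Finset.prod_congr rfl fun k hk => h k (Finset.mem_Ico.1 hk).1 (Finset.mem_Ico.1 hk).2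

theorem intervalSum_one (A B : ℕ → R[X]) (a : ℕ) : intervalSum A B a 1 = B a := by
  simp [intervalSum, intervalProd]

/-- This is the numerator in the addition of two fractions, the sum being that of the B_k/A_k over a
common denominator. -/
theorem intervalSum_add (A B : ℕ → R[X]) (a h m : ℕ) :
    intervalSum A B a (h + m) = intervalSum A B a h * intervalProd A (a + h) m +
      intervalSum A B (a + h) m * intervalProd A a h := by
  rw [intervalSum, intervalSum, intervalSum, ← add_assoc,
    ← Finset.sum_Ico_consecutive _ (by omega : a ≤ a + h) (by omega), Finset.sum_mul,
    Finset.sum_mul]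
  congr 1
  · refine Finset.sum_congr rfl fun k hk => ?_
    rw [intervalProd_add, mul_assoc, intervalProd_congr (a := a + h) (A' := A)]
    intro j h1 _
    exact Function.update_of_ne (by have := Finset.mem_Ico.1 hk; omega) _ _
  · refine Finset.sum_congr rfl fun k hk => ?_
    rw [intervalProd_add, intervalProd_congr (a := a) (A' := A)]
    · ring
    intro j h1 _
    exact Function.update_of_ne (by have := Finset.mem_Ico.1 hk; omega) _ _

theorem natDegree_intervalSum_lt {A B : ℕ → R[X]} {a m d : ℕ} (hm : 0 < m)
    (hA : ∀ k, a ≤ k → k < a + m → (A k).natDegree ≤ d)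
    (hB : ∀ k, a ≤ k → k < a + m → (B k).natDegree < d) :
    (intervalSum A B a m).natDegree < m * d := by
  have hd : 0 < d := (Nat.zero_le _).trans_lt (hB a le_rfl (by omega))
  have : (intervalSum A B a m).natDegree ≤ m * d - 1 := by
    refine natDegree_sum_le_of_forall_le _ _ fun k hk => ?_
    have hk' := Finset.mem_Ico.1 hk
    have h1 : (intervalProd (Function.update A k 1) a m).natDegree ≤ (m - 1) * d := by
      rw [intervalProd, ← Finset.mul_prod_erase _ _ hk, Function.update_self, one_mul]
      refine (natDegree_prod_le _ _).trans
        ((Finset.sum_le_card_nsmul _ _ d fun j hj => ?_).trans ?_)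
      · rw [Function.update_of_ne (Finset.ne_of_mem_erase hj)]
        have := Finset.mem_Ico.1 (Finset.mem_of_mem_erase hj)
        exact hA j this.1 this.2
      · rw [Finset.card_erase_of_mem hk]
        simp
    have h2 := hB k hk'.1 hk'.2
    have h3 : (m - 1) * d + d = m * d := by
      obtain ⟨m, rfl⟩ : ∃ n, m = n + 1 := ⟨m - 1, by omega⟩
      simp [add_mul]
    exact natDegree_mul_le.trans (by omega)
  have : 0 < m * d := Nat.mul_pos hm hd
  omega

theorem clog_half {m : ℕ} (hm : 2 ≤ m) :
    Nat.clog 2 (m / 2) + 1 ≤ Nat.clog 2 m ∧ Nat.clog 2 (m - m / 2) + 1 ≤ Nat.clog 2 m := by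
  rw [Nat.clog_of_two_le (n := m) (by norm_num) hm]
  exact ⟨by gcongr; omega, by gcongr; omega⟩

/-- The divide and conquer recurrence: work c m d at each node adds one level to the logarithm. -/
theorem clog_half_cost {m d : ℕ} (hm : 2 ≤ m) {c : ℝ} (hc : 0 ≤ c) :
    c * ((m / 2 : ℕ) : ℝ) * d * Nat.clog 2 (m / 2) +
      c * ((m - m / 2 : ℕ) : ℝ) * d * Nat.clog 2 (m - m / 2) + c * m * d ≤
      c * m * d * Nat.clog 2 m := by
  have h1 : (Nat.clog 2 (m / 2) : ℝ) ≤ Nat.clog 2 m - 1 := by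
    have := (clog_half hm).1
    rw [le_sub_iff_add_le]
    exact_mod_cast this
  have h2 : (Nat.clog 2 (m - m / 2) : ℝ) ≤ Nat.clog 2 m - 1 := by
    have := (clog_half hm).2
    rw [le_sub_iff_add_le]
    exact_mod_cast this
  have h3 : ((m / 2 : ℕ) : ℝ) + ((m - m / 2 : ℕ) : ℝ) = m := by
    exact_mod_cast (by omega : m / 2 + (m - m / 2) = m)
  have h4 := mul_le_mul_of_nonneg_left h1 (by positivity : 0 ≤ c * ((m / 2 : ℕ) : ℝ) * d)
  have h5 := mul_le_mul_of_nonneg_left h2 (by positivity : 0 ≤ c * ((m - m / 2 : ℕ) : ℝ) * d)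
  rw [← h3]
  linarith

theorem MulBound.node_cost (hμ : MulBound K R μ N) {m d : ℕ} (hm : 0 < m) (hd : 0 < d) :
    μ * ((m * d + 1 : ℕ) : ℝ) ≤ 2 * μ * m * d := by
  have h1 : (1 : ℝ) ≤ m * d := by exact_mod_cast Nat.mul_pos hm hd
  push_cast
  nlinarith [hμ.1]

/-- The products in a binary tree with leaves `A_k`, and the reduction of a polynomial to the
leaves. -/
theorem MulBound.exists_tree (hμ : MulBound K R μ N) {A : ℕ → R[X]} {d : ℕ} (hd : 0 < d) (m : ℕ) :
    0 < m → ∀ (a : ℕ) (S : Set R), m * d + 1 ≤ N →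
    (∀ k, a ≤ k → k < a + m → (A k).natDegree ≤ d) →
    (∀ k, a ≤ k → k < a + m → coeffs (A k) ⊆ avail K S) →
    ∃ T : Set R, Reach K S (2 * μ * m * d * Nat.clog 2 m) T ∧
      coeffs (intervalProd A a m) ⊆ avail K T ∧
      ∀ f s, IsScaledRem (m * d) f (intervalProd A a m) s → ∃ t : ℕ → R[X],
        (∀ k, a ≤ k → k < a + m → IsScaledRem d f (A k) (t k)) ∧
        ∀ S', T ⊆ avail K S' → coeffs s ⊆ avail K S' →
          Reach K S' (4 * μ * m * d * Nat.clog 2 m) (⋃ k ∈ Finset.Ico a (a + m), coeffs (t k)) := by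
  induction m using Nat.strong_induction_on with
  | _ m ih =>
  intro hm a S hN hdeg hS
  have hμ0 : 0 ≤ μ := zero_le_one.trans hμ.1
  rcases Nat.lt_or_ge m 2 with hm2 | hm2
  · obtain rfl : m = 1 := by omega
    rw [intervalProd_one]
    refine ⟨coeffs (A a), .done (by simp) (hS a le_rfl (by omega)), subset_avail,
      fun f s hs => ⟨fun _ => s, fun k h1 h2 => ?_, fun S' _ hs' => .done (by simp) (by simpa)⟩⟩
    obtain rfl : k = a := by omega
    simpa using hs
  · have hmd : m / 2 * d + (m - m / 2) * d = m * d := by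
      rw [← add_mul]
      congr 1
      omega
    have hpos1 : 0 < m / 2 * d := Nat.mul_pos (by omega) hd
    have hpos2 : 0 < (m - m / 2) * d := Nat.mul_pos (by omega) hd
    have hprod : intervalProd A a m =
        intervalProd A a (m / 2) * intervalProd A (a + m / 2) (m - m / 2) := by
      rw [← intervalProd_add]
      congr 1
      omega
    obtain ⟨T₁, hT₁, hP₁, down₁⟩ := ih (m / 2) (by omega) (by omega) a S (by omega)
      (fun k h1 h2 => hdeg k h1 (by omega)) fun k h1 h2 => hS k h1 (by omega)
    obtain ⟨T₂, hT₂, hP₂, down₂⟩ := ih (m - m / 2) (by omega) (by omega) (a + m / 2) S (by omega)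
      (fun k h1 h2 => hdeg k (by omega) (by omega)) fun k h1 h2 => hS k (by omega) (by omega)
    have hd₁ : (intervalProd A a (m / 2)).natDegree ≤ m / 2 * d :=
      natDegree_intervalProd_le fun k h1 h2 => hdeg k h1 (by omega)
    have hd₂ : (intervalProd A (a + m / 2) (m - m / 2)).natDegree ≤ (m - m / 2) * d :=
      natDegree_intervalProd_le fun k h1 h2 => hdeg k (by omega) (by omega)
    have hnode := hμ.node_cost hm hd
    rw [hprod]
    set P₁ := intervalProd A a (m / 2)
    set P₂ := intervalProd A (a + m / 2) (m - m / 2)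
    refine ⟨T₁ ∪ T₂ ∪ coeffs (P₁ * P₂), ?_, subset_avail.trans (avail_mono Set.subset_union_right),
      ?_⟩
    · refine (hT₁.union hT₂).bind' (c' := 2 * μ * m * d) ?_ fun S' _ hT => ?_
      · have := clog_half_cost (d := d) hm2 (c := 2 * μ) (by positivity)
        linarith
      · have hT' := Set.union_subset_iff.1 hT
        refine (hμ.reach hN (f := P₁) (g := P₂) (by omega) (by omega)
          (hP₁.trans (avail_subset hT'.1)) (hP₂.trans (avail_subset hT'.2))).bind' (c' := 0)
          (by linarith) fun S'' h'' hT'' => ?_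
        exact .done le_rfl (Set.union_subset (hT.trans (avail_mono h'')) hT'')
    -- Each child receives a middle slice of `s` times the product of its sibling: two
    -- multiplications per node, against one for building the tree.
    · intro f s hs
      have hs₁ : IsScaledRem (m / 2 * d) f P₁
          (polyOf (m / 2 * d) fun i => (s * P₂).coeff (i + (m - m / 2) * d)) :=
        IsScaledRem.of_mul hpos1 hd₁ hd₂ (by rwa [hmd])
      have hs₂ : IsScaledRem ((m - m / 2) * d) f P₂
          (polyOf ((m - m / 2) * d) fun i => (s * P₁).coeff (i + m / 2 * d)) :=
        IsScaledRem.of_mul hpos2 hd₂ hd₁ (by rwa [add_comm, hmd, mul_comm P₂])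
      obtain ⟨t₁, ht₁, r₁⟩ := down₁ _ _ hs₁
      obtain ⟨t₂, ht₂, r₂⟩ := down₂ _ _ hs₂
      refine ⟨fun k => if k < a + m / 2 then t₁ k else t₂ k, fun k h1 h2 => ?_, fun S' hT hsS => ?_⟩
      · by_cases hk : k < a + m / 2
        · simpa [hk] using ht₁ k h1 hk
        · simpa [hk] using ht₂ k (by omega) (by omega)
      · simp only [Set.union_subset_iff] at hT
        have hsd := hs.1
        refine ((hμ.reach hN (f := s) (g := P₂) (by omega) (by omega) hsS
          (hP₂.trans (avail_subset hT.1.2))).union (hμ.reach hN (f := s) (g := P₁) (by omega)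
          (by omega) hsS (hP₁.trans (avail_subset hT.1.1)))).bind'
          (c' := 4 * μ * ((m / 2 : ℕ) : ℝ) * d * Nat.clog 2 (m / 2) +
            4 * μ * ((m - m / 2 : ℕ) : ℝ) * d * Nat.clog 2 (m - m / 2)) ?_ fun S'' h'' hT'' => ?_
        · have := clog_half_cost (d := d) hm2 (c := 4 * μ) (by positivity)
          linarith
        · have hT3 := Set.union_subset_iff.1 hT''
          refine ((r₁ S'' (hT.1.1.trans (avail_mono h''))
            (coeffs_polyOf fun i _ => coeffs_subset.1 hT3.1 _)).union
            (r₂ S'' (hT.1.2.trans (avail_mono h''))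
            (coeffs_polyOf fun i _ => coeffs_subset.1 hT3.2 _))).of_subset ?_
          refine Set.iUnion₂_subset fun k hk => Set.Subset.trans ?_ subset_avail
          have hk' := Finset.mem_Ico.1 hk
          by_cases hk2 : k < a + m / 2
          · simp only [if_pos hk2]
            exact (Set.subset_biUnion_of_mem (u := fun k => coeffs (t₁ k))
              (Finset.mem_coe.2 (Finset.mem_Ico.2 ⟨hk'.1, hk2⟩))).trans Set.subset_union_left
          · simp only [if_neg hk2]
            exact (Set.subset_biUnion_of_mem (u := fun k => coeffs (t₂ k))
              (Finset.mem_coe.2 (Finset.mem_Ico.2 ⟨by omega, by omega⟩))).trans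
              Set.subset_union_right

/-- The recombination of `∑_k B_k ∏_{j ≠ k} A_j` along a binary tree. -/
theorem MulBound.reach_intervalSum (hμ : MulBound K R μ N) {A B : ℕ → R[X]} {d : ℕ} (hd : 0 < d) (m : ℕ) :
    0 < m → ∀ (a : ℕ), m * d + 1 ≤ N →
    (∀ k, a ≤ k → k < a + m → (A k).natDegree ≤ d) →
    (∀ k, a ≤ k → k < a + m → (B k).natDegree < d) →
    (∀ k, a ≤ k → k < a + m → coeffs (A k) ⊆ avail K S) →
    (∀ k, a ≤ k → k < a + m → coeffs (B k) ⊆ avail K S) →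
    Reach K S (7 * μ * m * d * Nat.clog 2 m)
      (coeffs (intervalProd A a m) ∪ coeffs (intervalSum A B a m)) := by
  induction m using Nat.strong_induction_on with
  | _ m ih =>
  intro hm a hN hAd hBd hA hB
  have hμ0 : 0 ≤ μ := zero_le_one.trans hμ.1
  rcases Nat.lt_or_ge m 2 with hm2 | hm2
  · obtain rfl : m = 1 := by omega
    rw [intervalProd_one, intervalSum_one]
    exact .done (by simp) (Set.union_subset (hA a le_rfl (by omega)) (hB a le_rfl (by omega)))
  · have hmd : m / 2 * d + (m - m / 2) * d = m * d := by
      rw [← add_mul]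
      congr 1
      omega
    have hpos1 : 0 < m / 2 * d := Nat.mul_pos (by omega) hd
    have hpos2 : 0 < (m - m / 2) * d := Nat.mul_pos (by omega) hd
    have hprod : intervalProd A a m =
        intervalProd A a (m / 2) * intervalProd A (a + m / 2) (m - m / 2) := by
      rw [← intervalProd_add]
      congr 1
      omega
    have hsum : intervalSum A B a m =
        intervalSum A B a (m / 2) * intervalProd A (a + m / 2) (m - m / 2) +
        intervalSum A B (a + m / 2) (m - m / 2) * intervalProd A a (m / 2) := by
      rw [← intervalSum_add]
      congr 1
      omega
    have r₁ := ih (m / 2) (by omega) (by omega) a (by omega)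
      (fun k h1 h2 => hAd k h1 (by omega)) (fun k h1 h2 => hBd k h1 (by omega))
      (fun k h1 h2 => hA k h1 (by omega)) fun k h1 h2 => hB k h1 (by omega)
    have r₂ := ih (m - m / 2) (by omega) (by omega) (a + m / 2) (by omega)
      (fun k h1 h2 => hAd k (by omega) (by omega)) (fun k h1 h2 => hBd k (by omega) (by omega))
      (fun k h1 h2 => hA k (by omega) (by omega)) fun k h1 h2 => hB k (by omega) (by omega)
    have hd₁ : (intervalProd A a (m / 2)).natDegree ≤ m / 2 * d :=
      natDegree_intervalProd_le fun k h1 h2 => hAd k h1 (by omega)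
    have hd₂ : (intervalProd A (a + m / 2) (m - m / 2)).natDegree ≤ (m - m / 2) * d :=
      natDegree_intervalProd_le fun k h1 h2 => hAd k (by omega) (by omega)
    have he₁ : (intervalSum A B a (m / 2)).natDegree < m / 2 * d :=
      natDegree_intervalSum_lt (by omega) (fun k h1 h2 => hAd k h1 (by omega))
        fun k h1 h2 => hBd k h1 (by omega)
    have he₂ : (intervalSum A B (a + m / 2) (m - m / 2)).natDegree <
        (m - m / 2) * d :=
      natDegree_intervalSum_lt (by omega) (fun k h1 h2 => hAd k (by omega) (by omega))
        fun k h1 h2 => hBd k (by omega) (by omega)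
    have hnode := hμ.node_cost hm hd
    have hadd : ((m * d : ℕ) : ℝ) ≤ μ * m * d := by
      push_cast
      nlinarith [mul_le_mul_of_nonneg_right hμ.1 (by positivity : (0 : ℝ) ≤ m * d)]
    rw [hprod, hsum]
    set P₁ := intervalProd A a (m / 2)
    set P₂ := intervalProd A (a + m / 2) (m - m / 2)
    set Q₁ := intervalSum A B a (m / 2)
    set Q₂ := intervalSum A B (a + m / 2) (m - m / 2)
    refine (r₁.union r₂).bind' (c' := 7 * μ * m * d) ?_ fun S₁ h₁ hT₁ => ?_
    · have := clog_half_cost (d := d) hm2 (c := 7 * μ) (by positivity)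
      linarith
    simp only [Set.union_subset_iff] at hT₁
    obtain ⟨⟨hP₁, hQ₁⟩, hP₂, hQ₂⟩ := hT₁
    -- Three products within 2μmd each and one addition within μmd account for the factor 7.
    refine (((hμ.reach hN (f := P₁) (g := P₂) (by omega) (by omega) hP₁ hP₂).union
      (hμ.reach hN (f := Q₁) (g := P₂) (by omega) (by omega) hQ₁ hP₂)).union
      (hμ.reach hN (f := Q₂) (g := P₁) (by omega) (by omega) hQ₂ hP₁)).bind'
      (c' := μ * m * d) (by linarith) fun S₂ h₂ hT₂ => ?_
    simp only [Set.union_subset_iff] at hT₂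
    obtain ⟨⟨hP, hQ⟩, hQ'⟩ := hT₂
    refine (Reach.coeffs_add (n := m * d) (natDegree_mul_le.trans_lt (by omega))
      (natDegree_mul_le.trans_lt (by omega)) hQ hQ').bind' (c' := 0) (by linarith)
      fun S₃ h₃ hT₃ => .done le_rfl (Set.union_subset (hP.trans (avail_mono h₃)) hT₃)

end Tree

/-! ### Hermite evaluation and interpolation -/

theorem biUnion_subset_iff {R : Type*} {m : ℕ} {T : ℕ → Set R} {U : Set R} :
    (⋃ k ∈ Finset.range m, T k) ⊆ U ↔ ∀ k < m, T k ⊆ U := by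
  simp [Set.iUnion_subset_iff]

section Hermite

variable {K R : Type*} [Field K] [CommRing R] [Algebra K R] {S : Set R} {μ : ℝ} {N : ℕ}

theorem taylor_X_sub_C_pow (α : R) (e : ℕ) : taylor α ((X - C α) ^ e) = X ^ e := by
  rw [taylor_pow, map_sub, taylor_X, taylor_C, add_sub_cancel_right]

theorem taylor_neg_taylor (α : R) (f : R[X]) : taylor (-α) (taylor α f) = f := by
  rw [taylor_taylor, neg_add_cancel, taylor_zero]

theorem taylor_neg_X_pow (α : R) (e : ℕ) : taylor (-α) (X ^ e) = (X - C α) ^ e := by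
  rw [taylor_X_pow, C_neg, sub_eq_add_neg]

theorem X_sub_C_pow_dvd_iff (α : R) (e : ℕ) (f : R[X]) :
    (X - C α) ^ e ∣ f ↔ X ^ e ∣ taylor α f := by
  constructor
  · rintro ⟨g, rfl⟩
    rw [taylor_mul, taylor_X_sub_C_pow]
    exact dvd_mul_right _ _
  · rintro ⟨g, hg⟩
    rw [← taylor_neg_taylor α f, hg, taylor_mul, taylor_neg_X_pow]
    exact dvd_mul_right _ _

theorem natDegree_X_sub_C_pow_le (α : R) (e : ℕ) : ((X - C α) ^ e).natDegree ≤ e :=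
  natDegree_pow_le_of_le e (natDegree_X_sub_C_le α) |>.trans (by simp)

theorem Reach.neg {a : R} (ha : a ∈ avail K S) : Reach K S 1 {-a} := by
  simpa using Reach.sub (K := K) (S := S) zero_mem_avail ha

/-- The power (X - α)^e is the Taylor shift of X^e by -α. -/
theorem MulBound.reach_X_sub_C_pow [CharZero K] (hμ : MulBound K R μ N) {e : ℕ} (he : 0 < e)
    (hN : e + 1 ≤ N) {α : R} (hα : α ∈ avail K S) :
    Reach K S (11 * μ * e) (coeffs ((X - C α) ^ e)) := by
  have h1 : (1 : ℝ) ≤ e := by exact_mod_cast he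
  refine (Reach.neg hα).bind' (c' := 5 * μ * ((e + 1 : ℕ) : ℝ)) ?_ fun S' _ hT => ?_
  · push_cast
    nlinarith [hμ.1, mul_le_mul hμ.1 h1 zero_le_one (zero_le_one.trans hμ.1)]
  · rw [← taylor_neg_X_pow]
    exact hμ.reach_taylor (by omega) hN ((natDegree_X_pow_le _).trans_lt (by omega))
      (hT rfl) (coeffs_X_pow _)

theorem monic_intervalProd (α : ℕ → R) (e a m : ℕ) :
    (intervalProd (fun k => (X - C (α k)) ^ e) a m).Monic :=
  monic_prod_of_monic _ _ fun k _ => (monic_X_sub_C (α k)).pow e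

theorem natDegree_intervalProd [Nontrivial R] (α : ℕ → R) (e a m : ℕ) :
    (intervalProd (fun k => (X - C (α k)) ^ e) a m).natDegree = m * e := by
  rw [intervalProd, natDegree_prod_of_monic _ _ fun k _ => (monic_X_sub_C (α k)).pow e]
  simp [(monic_X_sub_C _).natDegree_pow]

/-- Simultaneous Taylor expansion to order `e` at `m` points. -/
theorem MulBound.hermite_eval [CharZero K] [Nontrivial R] (hμ : MulBound K R μ N) {e m : ℕ}
    (he : 0 < e) (hm : 0 < m) (hN : m * e + 1 ≤ N) {α : ℕ → R} (hα : ∀ k < m, α k ∈ avail K S)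
    {f : R[X]} (hf : f.natDegree < m * e) (hfS : coeffs f ⊆ avail K S) :
    Reach K S (22 * μ * m * e * (Nat.clog 2 (m * e) + 1))
      (⋃ k ∈ Finset.range m, coeffs (polyOf e (taylor (α k) f).coeff)) := by
  have hμ0 : 0 ≤ μ := zero_le_one.trans hμ.1
  have heN : e + 1 ≤ N := by
    have : 1 * e ≤ m * e := Nat.mul_le_mul_right e hm
    omega
  set n := m * e with hn
  have hn0 : 0 < n := Nat.mul_pos hm he
  set L : ℝ := (Nat.clog 2 n : ℝ) with hL
  have hL0 : 0 ≤ L := Nat.cast_nonneg _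
  have hLm : (Nat.clog 2 m : ℝ) ≤ L := by
    rw [hL]
    exact_mod_cast Nat.clog_mono_right 2 (Nat.le_mul_of_pos_right m he)
  set w : ℝ := μ * m * e with hw
  have hw0 : 0 ≤ w := by positivity
  have hwL := mul_le_mul_of_nonneg_left hLm hw0
  have hwL0 := mul_nonneg hw0 hL0
  have hnw : μ * (n : ℝ) = w := by rw [hn, hw]; push_cast; ring
  set A : ℕ → R[X] := fun k => (X - C (α k)) ^ e with hA
  have hAd : ∀ k, (A k).natDegree ≤ e := fun k => natDegree_X_sub_C_pow_le _ _
  refine (Reach.range fun k hk => hμ.reach_X_sub_C_pow he heN (hα k hk)).bind'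
    (c' := 11 * w + 22 * (w * L)) (by rw [hw]; linarith) fun S₁ h₁ hT₁ => ?_
  rw [biUnion_subset_iff] at hT₁
  obtain ⟨T, hT, hP, down⟩ := hμ.exists_tree (A := A) he m hm 0 S₁ hN (fun k _ _ => hAd k)
    fun k _ hk => hT₁ k (by omega)
  set P := intervalProd A 0 m with hPdef
  have hPd : P.natDegree = n := natDegree_intervalProd α e 0 m
  refine hT.bind' (c' := 11 * w + 20 * (w * L)) (by rw [hw] at *; linarith) fun S₂ h₂ hT₂ => ?_
  have hPS : coeffs P ⊆ avail K S₂ := hP.trans (avail_subset hT₂)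
  -- `P` is monic, so its reversal has constant coefficient 1; evaluation needs no distinctness of
  -- the points.
  obtain ⟨g, hg, hdvd, hreach⟩ := hμ.inverse (S := S₂) hn0 (by omega) (f := reflect n P) (by
    rw [coeff_reflect, revAt_le (Nat.zero_le _), Nat.sub_zero, ← hPd,
      (monic_intervalProd α e 0 m).coeff_natDegree]
    exact isUnit_one) fun i _ => by
      rw [coeff_reflect]
      exact coeffs_subset.1 hPS _
  have hrem := isScaledRem_of_inverse hn0 hPd.le hf hg hdvd
  obtain ⟨t, ht, htreach⟩ := down f _ hrem
  refine hreach.bind' (c' := 8 * w + 17 * (w * L))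
    (by rw [mul_assoc 3 μ, hnw]; linarith) fun S₃ h₃ hT₃ => ?_
  refine (hμ.reach (n := n) (f := f) (g := reflect (n - 1) g) (by omega) hf ?_
    (hfS.trans (avail_mono (h₁.trans (h₂.trans h₃)))) (coeffs_subset.2 fun i => ?_)).bind'
    (c' := 7 * w + 17 * (w * L)) (by linarith) fun S₄ h₄ hT₄ => ?_
  · refine natDegree_lt_of_coeff hn0 fun i hi => ?_
    rw [coeff_reflect, revAt_eq_self_of_lt (by omega), coeff_eq_zero_of_lt hg hi]
  · rw [coeff_reflect]
    exact coeffs_subset.1 hT₃ _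
  refine (htreach S₄ (hT₂.trans (avail_mono (h₃.trans h₄)))
    (coeffs_polyOf fun i _ => coeffs_subset.1 hT₄ _)).bind' (c' := 7 * w + 13 * (w * L))
    (by rw [hw] at *; linarith) fun S₅ h₅ hT₅ => ?_
  have ht₅ : ∀ k < m, coeffs (t k) ⊆ avail K S₅ := by
    rw [zero_add, ← Finset.range_eq_Ico, biUnion_subset_iff] at hT₅
    exact hT₅
  have hmono : S₁ ⊆ S₅ := h₂.trans (h₃.trans (h₄.trans h₅))
  refine (Reach.range (n := m) (c := 7 * μ * e) fun k hk => ?_).le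
    (by rw [hw] at *; nlinarith)
  obtain ⟨q, hq⟩ := (ht k (Nat.zero_le _) (by omega)).eq_mul_add (hAd k)
  set rem := polyOf e fun i => (t k * A k).coeff (i + e) with hrem
  have hremd : rem.natDegree < e := natDegree_polyOf_lt he _
  -- Modulo (X - α_k)^e, f agrees with `rem`; after the shift this is agreement modulo X^e, and
  -- `rem` has degree below e.
  have htay : polyOf e (taylor (α k) f).coeff = taylor (α k) rem := by
    ext i
    rw [coeff_polyOf, hq, map_add, taylor_mul, hA, taylor_X_sub_C_pow, coeff_add,
      coeff_mul_X_pow']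
    split_ifs with h1 h2
    · omega
    · rw [zero_add]
    · exact (coeff_eq_zero_of_natDegree_lt (by rw [natDegree_taylor]; omega)).symm
  rw [htay]
  have htd := (ht k (Nat.zero_le _) (by omega)).1
  refine (hμ.reach heN (f := t k) (g := A k) (by omega) (Nat.lt_succ_of_le (hAd k)) (ht₅ k hk)
    ((hT₁ k hk).trans (avail_mono hmono))).bind' (c' := 5 * μ * e) ?_ fun S₆ h₆ hT₆ => ?_
  · have := hμ.node_cost (m := 1) one_pos he
    simp only [one_mul, Nat.cast_one, mul_one] at this
    linarith
  · exact hμ.reach_taylor he (by omega) hremd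
      (avail_mono (h₁.trans (hmono.trans h₆)) (hα k hk))
      (coeffs_polyOf fun i _ => coeffs_subset.1 hT₆ _)

/-- Chinese remaindering: the difference is divisible by all (X - α_k)^d, which are pairwise
coprime, hence by their product, which is monic of larger degree. Unit differences and monicity
replace a domain hypothesis, since function rings have zero divisors. -/
theorem eq_intervalSum [Nontrivial R] {d m : ℕ} (hm : 0 < m) {α : ℕ → R}
    (hα : ∀ j < m, ∀ k < m, j ≠ k → IsUnit (α j - α k)) {f : R[X]} (hf : f.natDegree < m * d)
    {B : ℕ → R[X]} (hBd : ∀ k < m, (B k).natDegree < d)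
    (hB : ∀ k < m, X ^ d ∣ taylor (α k) (f - B k *
      intervalProd (Function.update (fun k => (X - C (α k)) ^ d) k 1) 0 m)) :
    f = intervalSum (fun k => (X - C (α k)) ^ d) B 0 m := by
  set A : ℕ → R[X] := fun k => (X - C (α k)) ^ d with hA
  have hdvd : intervalProd A 0 m ∣ f - intervalSum A B 0 m := by
    refine Finset.prod_dvd_of_coprime ?_ fun k hk => ?_
    · intro j hj k hk hjk
      simp only [zero_add, Finset.coe_Ico, Set.mem_Ico] at hj hk
      exact (isCoprime_X_sub_C_of_isUnit_sub (hα j hj.2 k hk.2 hjk)).pow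
    · have hkm : k < m := by simpa using hk
      rw [intervalSum, ← Finset.add_sum_erase _ _ hk, ← sub_sub]
      refine dvd_sub ((X_sub_C_pow_dvd_iff _ _ _).2 (hB k hkm)) (Finset.dvd_sum fun j hj => ?_)
      refine Dvd.dvd.mul_left ?_ _
      rw [intervalProd]
      have := Finset.dvd_prod_of_mem (Function.update A j 1) hk
      rwa [Function.update_of_ne (Finset.ne_of_mem_erase hj).symm] at this
  rw [← sub_eq_zero]
  by_contra h0
  refine (monic_intervalProd α d 0 m).not_dvd_of_natDegree_lt h0 ?_ hdvd
  rw [natDegree_intervalProd]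
  refine (natDegree_sub_le _ _).trans_lt (max_lt hf ?_)
  exact natDegree_intervalSum_lt hm (fun k _ _ => natDegree_X_sub_C_pow_le _ _)
    fun k _ hk => hBd k (by omega)

/-- With P the product of the (X - α_k)^d, the numerator B_k of f/P at α_k is f times the inverse of
the cofactor P/(X - α_k)^d, modulo (X - α_k)^d. The B_k are computed locally, as power series at
α_k, and recombined along the tree. -/
theorem MulBound.hermite_interp [CharZero K] [Nontrivial R] (hμ : MulBound K R μ N) {d m : ℕ}
    (hd : 0 < d) (hm : 0 < m) (hN : m * (2 * d) + 1 ≤ N) {α : ℕ → R}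
    (hα : ∀ k < m, α k ∈ avail K S) (hα' : ∀ j < m, ∀ k < m, j ≠ k → IsUnit (α j - α k))
    {f : R[X]} (hf : f.natDegree < m * d)
    (hfS : ∀ k < m, coeffs (polyOf d (taylor (α k) f).coeff) ⊆ avail K S) :
    Reach K S (65 * μ * m * d * (Nat.clog 2 (m * (2 * d)) + 1)) (coeffs f) := by
  have hμ0 : 0 ≤ μ := zero_le_one.trans hμ.1
  have h2 : m * (2 * d) = m * d + m * d := by ring
  have hmd : 1 * d ≤ m * d := Nat.mul_le_mul_right d hm
  have hmd0 : 0 < m * d := Nat.mul_pos hm hd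
  set L : ℝ := (Nat.clog 2 (m * (2 * d)) : ℝ) with hL
  have hL0 : 0 ≤ L := Nat.cast_nonneg _
  have hLm : (Nat.clog 2 m : ℝ) ≤ L := by
    rw [hL]
    exact_mod_cast Nat.clog_mono_right 2 (Nat.le_mul_of_pos_right m (by omega))
  have hLd : (Nat.clog 2 d : ℝ) ≤ L := by
    rw [hL]
    exact_mod_cast Nat.clog_mono_right 2 (by omega : d ≤ m * (2 * d))
  set w : ℝ := μ * m * d with hw
  have hw0 : 0 ≤ w := by positivity
  have hwL := mul_le_mul_of_nonneg_left hLm hw0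
  have hwLd := mul_le_mul_of_nonneg_left hLd hw0
  have hwL0 := mul_nonneg hw0 hL0
  set A : ℕ → R[X] := fun k => (X - C (α k)) ^ d with hA
  have hAd : ∀ k, (A k).natDegree ≤ d := fun k => natDegree_X_sub_C_pow_le _ _
  have e7 : 7 * μ * m * d * Nat.clog 2 m ≤ 7 * (w * L) := by rw [hw] at *; linarith
  refine (Reach.range fun k hk => hμ.reach_X_sub_C_pow hd (by omega) (hα k hk)).bind'
    (c' := 54 * w + 61 * (w * L)) (by rw [hw] at *; linarith) fun S₁ h₁ hT₁ => ?_
  rw [biUnion_subset_iff] at hT₁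
  -- Zero numerators: only the product `P` is wanted here.
  refine (hμ.reach_intervalSum (A := A) (B := 0) hd m hm 0 (by omega) (fun k _ _ => hAd k)
    (fun k _ _ => by simpa using hd) (fun k _ hk => hT₁ k (by omega)) (fun k _ _ => by
      simpa [coeffs_subset] using zero_mem_avail)).bind' (c' := 54 * w + 54 * (w * L))
    (by linarith) fun S₂ h₂ hT₂ => ?_
  have hP := Set.subset_union_left.trans hT₂
  set P := intervalProd A 0 m with hPdef
  have hPd : P.natDegree = m * d := natDegree_intervalProd α d 0 m
  -- The expansion of `P` at α_k is X^d times that of the cofactor, so order 2d yields every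
  -- cofactor to order d in one evaluation.
  refine (hμ.hermite_eval (e := 2 * d) (by omega) hm hN
    (fun k hk => avail_mono (h₁.trans h₂) (hα k hk)) (by omega) hP).bind'
    (c' := 10 * w + 10 * (w * L)) (by rw [hw] at *; push_cast; linarith) fun S₃ h₃ hT₃ => ?_
  rw [biUnion_subset_iff] at hT₃
  set W : ℕ → R[X] := fun k => taylor (α k) (intervalProd (Function.update A k 1) 0 m) with hW
  have hPW : ∀ k < m, taylor (α k) P = X ^ d * W k := fun k hk => by
    have hk' : k ∈ Finset.Ico 0 (0 + m) := by simpa using hk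
    rw [hW, ← taylor_X_sub_C_pow (α k), ← taylor_mul, hPdef, intervalProd, intervalProd,
      ← Finset.mul_prod_erase _ _ hk', ← Finset.mul_prod_erase _ _ hk', Function.update_self,
      one_mul]
    congr 2
    exact Finset.prod_congr rfl fun j hj =>
      (Function.update_of_ne (Finset.ne_of_mem_erase hj) _ _).symm
  have hWS : ∀ k < m, ∀ i < d, (W k).coeff i ∈ avail K S₃ := fun k hk i hi => by
    have := coeffs_subset.1 (hT₃ k hk) (i + d)
    rwa [coeff_polyOf, if_pos (by omega), hPW k hk, coeff_X_pow_mul] at this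
  -- This constant coefficient is ∏_{j ≠ k} (α_k - α_j)^d.
  have hW0 : ∀ k < m, IsUnit ((W k).coeff 0) := fun k hk => by
    have hk' : k ∈ Finset.Ico 0 (0 + m) := by simpa using hk
    rw [hW, taylor_coeff_zero, intervalProd, eval_prod, ← Finset.mul_prod_erase _ _ hk',
      Function.update_self, eval_one, one_mul, IsUnit.prod_iff]
    intro j hj
    have hjm : j < m := by simpa using Finset.mem_of_mem_erase hj
    rw [Function.update_of_ne (Finset.ne_of_mem_erase hj)]
    simpa [hA] using (hα' k hk j hjm (Finset.ne_of_mem_erase hj).symm).pow d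
  have hinv : ∀ k, ∃ g : R[X], k < m → g.natDegree < d ∧ X ^ d ∣ W k * g - 1 ∧
      Reach K S₃ (3 * μ * d * (Nat.clog 2 d + 1)) (coeffs g) := fun k => by
    by_cases hk : k < m
    · obtain ⟨g, hg⟩ := hμ.inverse hd (by omega) (hW0 k hk) (hWS k hk)
      exact ⟨g, fun _ => hg⟩
    · exact ⟨0, fun h => absurd h hk⟩
  choose g hg using hinv
  refine (Reach.range fun k hk => (hg k hk).2.2).bind' (c' := 7 * w + 7 * (w * L))
    (by rw [hw] at *; linarith) fun S₄ h₄ hT₄ => ?_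
  rw [biUnion_subset_iff] at hT₄
  set F : ℕ → R[X] := fun k => polyOf d (taylor (α k) f).coeff with hF
  have hFd : ∀ k, (F k).natDegree < d := fun k => natDegree_polyOf_lt hd _
  set V : ℕ → R[X] := fun k => polyOf d (F k * g k).coeff with hV
  have hVd : ∀ k, (V k).natDegree < d := fun k => natDegree_polyOf_lt hd _
  set B : ℕ → R[X] := fun k => taylor (-α k) (V k) with hB
  have hBd : ∀ k, (B k).natDegree < d := fun k => by
    rw [hB, natDegree_taylor]
    exact hVd k
  have hS₄ : S ⊆ S₄ := h₁.trans (h₂.trans (h₃.trans h₄))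
  have hn1 : (1 : ℝ) ≤ μ * d := by
    nlinarith [hμ.1, (by exact_mod_cast hd : (1 : ℝ) ≤ d)]
  refine (Reach.range (n := m) (c := 7 * μ * d) (T := fun k => coeffs (B k)) fun k hk => ?_).bind'
    (c' := 7 * (w * L)) (by rw [hw] at *; linarith) fun S₅ h₅ hT₅ => ?_
  · refine (hμ.reach (n := d) (by omega) (hFd k) (hg k hk).1 ((hfS k hk).trans (avail_mono hS₄))
      (hT₄ k hk)).bind' (c' := 6 * μ * d) (by linarith) fun S₅ h₅ hT₅ => ?_
    refine (Reach.neg (avail_mono (hS₄.trans h₅) (hα k hk))).bind' (c' := 5 * μ * d)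
      (by linarith) fun S₆ h₆ hT₆ => ?_
    exact hμ.reach_taylor hd (by omega) (hVd k) (hT₆ rfl)
      (coeffs_polyOf fun i _ => avail_mono h₆ (coeffs_subset.1 hT₅ i))
  · rw [biUnion_subset_iff] at hT₅
    have hfeq : f = intervalSum A B 0 m := by
      refine eq_intervalSum hm hα' hf (fun k _ => hBd k) fun k hk => ?_
      have hBV : taylor (α k) (B k) = V k := by
        rw [hB, taylor_taylor, add_neg_cancel, taylor_zero]
      rw [map_sub, taylor_mul, hBV]
      change X ^ d ∣ taylor (α k) f - V k * W k
      have h1 : X ^ d ∣ F k - taylor (α k) f := X_pow_dvd_polyOf_coeff_sub _ _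
      have h2 : X ^ d ∣ V k - F k * g k := X_pow_dvd_polyOf_coeff_sub _ _
      have heq : taylor (α k) f - V k * W k =
          -(F k - taylor (α k) f) - (V k - F k * g k) * W k - F k * (W k * g k - 1) := by ring
      rw [heq]
      exact dvd_sub (dvd_sub ((dvd_neg).2 h1) (h2.mul_right _)) ((hg k hk).2.1.mul_left _)
    rw [hfeq]
    refine ((hμ.reach_intervalSum hd m hm 0 (by omega) (fun k _ _ => hAd k) (fun k _ _ => hBd k)
      (fun k _ hk => (hT₁ k (by omega)).trans
        (avail_mono (h₂.trans (h₃.trans (h₄.trans h₅)))))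
      (fun k _ hk => hT₅ k (by omega))).le e7).of_subset
      (Set.subset_union_right.trans subset_avail)

end Hermite

/-! ### The matrix of a differential operator -/

section Bridge

variable {K : Type*} [Field K]

/-- Both sides are multiplicative and linear in L, so it suffices to check x and ∂; for ∂ it is (Q
e^{ax})' = (Q' + aQ) e^{ax}. -/
theorem action_single (a : K) (L : DiffOp K) : ∀ Q : K[X],
    ExpPoly.action K L (Finsupp.single a Q) =
      Finsupp.single a (DiffOp.polyAction K (DiffOp.twist a L) Q) := by
  obtain ⟨F, rfl⟩ := RingQuot.mkAlgHom_surjective K (WeylRel K) L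
  induction F using FreeAlgebra.induction with
  | grade0 c =>
    intro Q
    simp [Module.algebraMap_end_apply]
  | grade1 t =>
    intro Q
    cases t with
    | false =>
      change ExpPoly.action K (DiffOp.x K) _ =
        Finsupp.single a (DiffOp.polyAction K (DiffOp.twist a (DiffOp.x K)) Q)
      simp [ExpPoly.action, DiffOp.twist, DiffOp.polyAction]
    | true =>
      change ExpPoly.action K (DiffOp.del K) _ =
        Finsupp.single a (DiffOp.polyAction K (DiffOp.twist a (DiffOp.del K)) Q)
      simp [ExpPoly.action, DiffOp.twist, DiffOp.polyAction, Module.algebraMap_end_apply]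
  | mul F G hF hG =>
    intro Q
    rw [map_mul, map_mul, map_mul, map_mul, Module.End.mul_apply, hG, hF, Module.End.mul_apply]
  | add F G hF hG =>
    intro Q
    rw [map_add, map_add, map_add, map_add, LinearMap.add_apply, hF, hG, LinearMap.add_apply,
      Finsupp.single_add]

/-- The polynomial in `∂` that is the coefficient of `x ^ i` in `∑ c_{i,j} x^i ∂^j`. -/
noncomputable def delPoly {d r : ℕ} (c : Fin d × Fin r → K) (i : ℕ) : K[X] :=
  polyOf r fun j => if h : i < d ∧ j < r then c (⟨i, h.1⟩, ⟨j, h.2⟩) else 0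

/-- The coefficient of `x ^ l` in the image of `x ^ j` under `∑_{i < d} ∑_m t_{i,m} x^i ∂^m`. -/
def blockEntry {R : Type*} [CommRing R] (d : ℕ) (t : ℕ → ℕ → R) (l j : ℕ) : R :=
  ∑ m ∈ Finset.range (j + 1), (j.descFactorial m : R) *
    if j ≤ l + m ∧ l + m - j < d then t (l + m - j) m else 0

theorem twist_ofCoeffs {d r : ℕ} (hr : 0 < r) (a : K) (c : Fin d × Fin r → K) :
    DiffOp.polyAction K (DiffOp.twist a (DiffOp.ofCoeffs c)) =
      ∑ i : Fin d, LinearMap.mulLeft K X ^ (i : ℕ) *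
        ∑ m ∈ Finset.range r, (taylor a (delPoly c i)).coeff m • (derivative : K[X] →ₗ[K] K[X]) ^ m := by
  simp only [DiffOp.ofCoeffs, map_sum, map_smul, map_mul, map_pow]
  refine Finset.sum_congr rfl fun i _ => ?_
  have hx : DiffOp.polyAction K (DiffOp.twist a (DiffOp.x K)) = LinearMap.mulLeft K X := by
    simp [DiffOp.twist, DiffOp.polyAction]
  have hd : DiffOp.polyAction K (DiffOp.twist a (DiffOp.del K)) =
      aeval (derivative : Module.End K K[X]) (X + C a) := by
    simp [DiffOp.twist, DiffOp.polyAction]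
  have hdeg : (taylor a (delPoly c i)).natDegree < r := by
    rw [natDegree_taylor]
    exact natDegree_polyOf_lt hr _
  rw [hx]
  have h1 : ∑ m ∈ Finset.range r, (taylor a (delPoly c i)).coeff m •
      (derivative : Module.End K K[X]) ^ m = ∑ j : Fin r, c (i, j) •
        aeval (derivative : Module.End K K[X]) (X + C a) ^ (j : ℕ) := by
    have hdeg' : (delPoly c i).natDegree < r := natDegree_polyOf_lt hr _
    rw [← aeval_eq_sum_range' hdeg, taylor_apply, aeval_comp,
      aeval_eq_sum_range' hdeg',
      ← Fin.sum_univ_eq_sum_range (fun j => (delPoly c i).coeff j •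
        aeval (derivative : Module.End K K[X]) (X + C a) ^ j)]
    exact Finset.sum_congr rfl fun j _ => by simp [delPoly, coeff_polyOf]
  rw [show (∑ m ∈ Finset.range r, (taylor a (delPoly c i)).coeff m •
      (derivative : K[X] →ₗ[K] K[X]) ^ m) = _ from h1, hd, Finset.mul_sum]
  simp only [mul_smul_comm]

/-- A term x^i ∂^m contributes to x^l only if l + m = i + j, which fixes i, and ∂^m kills X^j for m
> j. So only Taylor coefficients of order below d enter. -/
theorem coeff_polyAction_X_pow {d r : ℕ} (hdr : d ≤ r) (a : K) (c : Fin d × Fin r → K)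
    {j : ℕ} (hj : j < d) (l : ℕ) :
    (DiffOp.polyAction K (DiffOp.twist a (DiffOp.ofCoeffs c)) (X ^ j)).coeff l =
      blockEntry d (fun i m => (taylor a (delPoly c i)).coeff m) l j := by
  rw [twist_ofCoeffs (by omega)]
  set t : ℕ → ℕ → K := fun i m => (taylor a (delPoly c i)).coeff m with ht
  have hterm : ∀ i m : ℕ, ((LinearMap.mulLeft K X ^ i : Module.End K K[X])
      (((t i m) • (derivative : Module.End K K[X]) ^ m) (X ^ j))).coeff l =
      if m ≤ j ∧ l + m = i + j then (j.descFactorial m : K) * t i m else 0 := fun i m => by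
    rw [LinearMap.smul_apply, Module.End.pow_apply derivative, iterate_derivative_X_pow_eq_smul,
      LinearMap.pow_mulLeft, LinearMap.mulLeft_apply, mul_smul_comm, coeff_smul, mul_smul_comm,
      coeff_smul, ← pow_add, coeff_X_pow]
    by_cases hm : m ≤ j
    · by_cases hl : l + m = i + j
      · rw [if_pos (by omega), if_pos ⟨hm, hl⟩]
        simp [mul_comm]
      · rw [if_neg (by omega), if_neg (by omega)]
        simp
    · rw [Nat.descFactorial_of_lt (by omega), if_neg (fun h => hm h.1 : ¬ (m ≤ j ∧ l + m = i + j))]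
      simp
  simp only [LinearMap.sum_apply, Module.End.mul_apply, map_sum, finsetSum_coeff]
  have h2 : ∀ i : Fin d, ∑ m ∈ Finset.range r, ((LinearMap.mulLeft K X ^ (i : ℕ) :
      Module.End K K[X]) (((t i m) • (derivative : Module.End K K[X]) ^ m) (X ^ j))).coeff l =
      ∑ m ∈ Finset.range (j + 1),
        if m ≤ j ∧ l + m = i + j then (j.descFactorial m : K) * t i m else 0 := fun i => by
    rw [← Finset.sum_subset (Finset.range_mono (by omega : j + 1 ≤ r)) fun m _ hm => ?_]
    · exact Finset.sum_congr rfl fun m _ => hterm i m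
    · rw [hterm, if_neg]
      simp at hm
      omega
  refine (Finset.sum_congr rfl fun i _ => h2 i).trans ?_
  rw [Finset.sum_comm, blockEntry]
  refine Finset.sum_congr rfl fun m hm => ?_
  have hm' := Finset.mem_range.1 hm
  split_ifs with h
  · rw [Finset.sum_eq_single ⟨l + m - j, h.2⟩]
    · rw [if_pos ⟨by omega, by simp; omega⟩]
    · intro i _ hi
      rw [if_neg]
      rintro ⟨-, h'⟩
      exact hi (Fin.ext (by simp; omega))
    · simp
  · rw [mul_zero]
    refine Finset.sum_eq_zero fun i _ => if_neg ?_
    rintro ⟨-, h'⟩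
    exact h ⟨by omega, by omega⟩

theorem natDegree_polyAction_lt {d r : ℕ} (hdr : d ≤ r) (a : K) (c : Fin d × Fin r → K)
    {j : ℕ} (hj : j < d) :
    (DiffOp.polyAction K (DiffOp.twist a (DiffOp.ofCoeffs c)) (X ^ j)).natDegree < 2 * d := by
  refine natDegree_lt_of_coeff (by omega) fun l hl => ?_
  rw [coeff_polyAction_X_pow hdr a c hj, blockEntry]
  refine Finset.sum_eq_zero fun m hm => ?_
  rw [if_neg (by omega), mul_zero]

theorem matrix_apply {p : ℕ} {α : Fin p → K} (hα : Function.Injective α) {m k : ℕ} (L : DiffOp K)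
    (s : Fin p × Fin m) (t : Fin p × Fin k) :
    ExpPoly.matrix α m k L s t = if s.1 = t.1 then
      DiffOp.polyMatrix m k (DiffOp.twist (α t.1) L) s.2 t.2 else 0 := by
  rw [ExpPoly.matrix, Matrix.of_apply, ExpPoly.mono, action_single]
  by_cases h : s.1 = t.1
  · rw [if_pos h, h, Finsupp.single_eq_same, DiffOp.polyMatrix, Matrix.of_apply]
  · rw [if_neg h, Finsupp.single_eq_of_ne fun h' => h (hα h'), coeff_zero]

theorem action_mono_eq_sum {d r p : ℕ} (hdr : d ≤ r) {α : Fin p → K} (hα : Function.Injective α)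
    (c : Fin d × Fin r → K) (t : Fin p × Fin d) :
    ExpPoly.action K (DiffOp.ofCoeffs c) (ExpPoly.mono (α t.1) t.2) =
      ∑ s : Fin p × Fin (2 * d), ExpPoly.matrix α (2 * d) d (DiffOp.ofCoeffs c) s t •
        ExpPoly.mono (α s.1) s.2 := by
  simp only [matrix_apply hα]
  rw [ExpPoly.mono, action_single, Fintype.sum_prod_type, Finset.sum_eq_single t.1]
  · conv_lhs => rw [← polyOf_coeff_self (natDegree_polyAction_lt hdr (α t.1) c t.2.2)]
    rw [polyOf, ← Fin.sum_univ_eq_sum_range (fun l => monomial l ((DiffOp.polyAction K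
      (DiffOp.twist (α t.1) (DiffOp.ofCoeffs c)) (X ^ (t.2 : ℕ))).coeff l)), Finsupp.single_finsetSum]
    refine Finset.sum_congr rfl fun l _ => ?_
    rw [if_pos rfl, DiffOp.polyMatrix, Matrix.of_apply, ExpPoly.mono, Finsupp.smul_single,
      ← C_mul_X_pow_eq_monomial, smul_eq_C_mul]
  · intro k _ hk
    refine Finset.sum_eq_zero fun l _ => ?_
    rw [if_neg hk, zero_smul]
  · simp

end Bridge

/-! ### The cost of passing between an operator and its matrix on polynomials -/

section Block

variable {K R : Type*} [Field K] [CommRing R] [Algebra K R] {S : Set R} {μ : ℝ} {N : ℕ}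

variable (R) in
/-- The polynomial `∑_{k < n} (c X) ^ k / k!`. -/
noncomputable def expPoly (c : K) (n : ℕ) : R[X] :=
  polyOf n fun k => algebraMap K R (c ^ k * (k.factorial : K)⁻¹)

theorem coeffs_expPoly (c : K) (n : ℕ) : coeffs (expPoly R c n) ⊆ avail K S :=
  coeffs_polyOf fun _ _ => const_mem_avail _

/-- The identity exp(X) exp(-X) = 1, from the binomial expansion of (1 - 1)^i. -/
theorem X_pow_dvd_expPoly_mul [CharZero K] (n : ℕ) :
    X ^ n ∣ expPoly R (1 : K) n * expPoly R (-1 : K) n - 1 := by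
  refine X_pow_dvd_iff.2 fun i hi => ?_
  have h : ∑ a ∈ Finset.range (i + 1), ((1 : K) ^ a * (a.factorial : K)⁻¹) *
      ((-1 : K) ^ (i - a) * ((i - a).factorial : K)⁻¹) = if i = 0 then 1 else 0 := by
    have h1 := add_pow (1 : K) (-1) i
    have h2 : (i.factorial : K) ≠ 0 := Nat.cast_ne_zero.2 i.factorial_ne_zero
    rw [add_neg_cancel, zero_pow_eq] at h1
    refine mul_left_cancel₀ h2 ?_
    rw [Finset.mul_sum]
    trans (if i = 0 then (1 : K) else 0)
    · rw [h1]
      refine Finset.sum_congr rfl fun a ha => ?_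
      rw [Nat.cast_choose K (Nat.lt_succ_iff.1 (Finset.mem_range.1 ha)), div_eq_mul_inv, mul_inv]
      ring
    · split_ifs with h0
      · simp [h0]
      · simp
  rw [coeff_sub, coeff_mul_eq_sum_range, coeff_one, sub_eq_zero]
  trans algebraMap K R (if i = 0 then 1 else 0)
  · rw [← h, map_sum]
    refine Finset.sum_congr rfl fun a ha => ?_
    have := Finset.mem_range.1 ha
    rw [expPoly, expPoly, coeff_polyOf, coeff_polyOf, if_pos (by omega), if_pos (by omega), ← map_mul]
  · split_ifs <;> simp

/-- The coefficients `t_{i,m}` with `i + d - m = e`, as a polynomial. -/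
noncomputable def diagPoly (d : ℕ) (t : ℕ → ℕ → R) (e : ℕ) : R[X] :=
  polyOf d fun m => if d ≤ m + e ∧ m + e < 2 * d then t (m + e - d) m else 0

/-- The entry at (l, j) involves the t_{i,m} with i - m = l - j, weighted by j!/(j-m)!: a
convolution with 1/k!. The index e is this difference shifted by d, to stay in the naturals. -/
theorem blockEntry_eq [CharZero K] {d : ℕ} (t : ℕ → ℕ → R) {l j e : ℕ} (hj : j < d)
    (he : e + j = l + d) : blockEntry d t l j =
      algebraMap K R (j.factorial : K) * (diagPoly d t e * expPoly R (1 : K) d).coeff j := by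
  rw [blockEntry, coeff_mul_eq_sum_range, Finset.mul_sum]
  refine Finset.sum_congr rfl fun m hm => ?_
  have hm' := Finset.mem_range.1 hm
  have h1 : m < d := by omega
  have h2 : j - m < d := by omega
  rw [diagPoly, expPoly, coeff_polyOf, coeff_polyOf, if_pos h1, if_pos h2]
  by_cases h : j ≤ l + m ∧ l + m - j < d
  · rw [if_pos h, if_pos (by omega), show m + e - d = l + m - j by omega, one_pow, one_mul,
      ← map_natCast (algebraMap K R), mul_comm (t _ _), ← mul_assoc, ← map_mul]
    congr 2
    rw [← Nat.factorial_mul_descFactorial (by omega : m ≤ j), Nat.cast_mul, mul_comm, ← mul_assoc,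
      inv_mul_cancel₀ (Nat.cast_ne_zero.2 (Nat.factorial_ne_zero _)), one_mul]
  · rw [if_neg h, if_neg (by omega), mul_zero, zero_mul, mul_zero]

/-- These coefficients correspond to negative row indices. The inversion needs them, and they are
known to vanish. -/
theorem coeff_diagPoly_mul_eq_zero {d : ℕ} (t : ℕ → ℕ → R) {j e : ℕ} (he : e + j < d) :
    (diagPoly d t e * expPoly R (1 : K) d).coeff j = 0 := by
  rw [coeff_mul_eq_sum_range]
  refine Finset.sum_eq_zero fun m hm => ?_
  have hm' := Finset.mem_range.1 hm
  rw [diagPoly, coeff_polyOf, if_pos (by omega), if_neg (by omega), zero_mul]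

theorem MulBound.reach_blockEntry [CharZero K] (hμ : MulBound K R μ N) {d : ℕ} (hd : 0 < d)
    (hN : d ≤ N) {t : ℕ → ℕ → R} (ht : ∀ i < d, ∀ m < d, t i m ∈ avail K S) :
    Reach K S (6 * μ * d * d) {v | ∃ l < 2 * d, ∃ j < d, v = blockEntry d t l j} := by
  have h1 : (d : ℝ) ≤ μ * d := by nlinarith [hμ.1, (d.cast_nonneg : (0 : ℝ) ≤ d)]
  -- Entries have e = l + d - j < 3d; in the converse direction e = i + d - m < 2d.
  refine ((Reach.range (n := 3 * d) (c := 2 * μ * d) (T := fun e => coeffs (polyOf d fun j =>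
    algebraMap K R (j.factorial : K) * (diagPoly d t e * expPoly R (1 : K) d).coeff j))
    fun e _ => ?_).of_subset ?_).le (by push_cast; linarith)
  · refine (hμ.reach hN (natDegree_polyOf_lt hd _) (natDegree_polyOf_lt hd _)
      (coeffs_polyOf (v := fun m => if d ≤ m + e ∧ m + e < 2 * d then t (m + e - d) m else 0)
        fun i hi => ?_) (coeffs_expPoly (1 : K) d)).bind' (c' := d) (by linarith)
        fun S' _ hT => ?_
    · split_ifs with h
      · exact ht _ (by omega) _ hi
      · exact zero_mem_avail
    · exact Reach.coeffs_polyOf_mul hd (fun i _ => const_mem_avail _)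
        fun i _ => coeffs_subset.1 hT i
  · rintro v ⟨l, hl, j, hj, rfl⟩
    refine subset_avail (Set.mem_biUnion (Finset.mem_coe.2 (Finset.mem_range.2
      (by omega : l + d - j < 3 * d))) ⟨j, ?_⟩)
    rw [coeff_polyOf, if_pos hj, blockEntry_eq (K := K) (e := l + d - j) t hj (by omega)]

theorem MulBound.reach_of_blockEntry [CharZero K] (hμ : MulBound K R μ N) {d : ℕ} (hd : 0 < d)
    (hN : d ≤ N) {t : ℕ → ℕ → R} (ht : ∀ l < 2 * d, ∀ j < d, blockEntry d t l j ∈ avail K S) :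
    Reach K S (4 * μ * d * d) {v | ∃ i < d, ∃ m < d, v = t i m} := by
  have h1 : (d : ℝ) ≤ μ * d := by nlinarith [hμ.1, (d.cast_nonneg : (0 : ℝ) ≤ d)]
  refine ((Reach.range (n := 2 * d) (c := 2 * μ * d) (T := fun e => coeffs (diagPoly d t e))
    fun e he => ?_).of_subset ?_).le (by push_cast; linarith)
  · set H := polyOf d fun j => algebraMap K R ((j.factorial : K)⁻¹) *
      if d ≤ e + j then blockEntry d t (e + j - d) j else 0 with hH
    have hdvd : X ^ d ∣ H - diagPoly d t e * expPoly R (1 : K) d := X_pow_dvd_iff.2 fun j hj => by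
      rw [coeff_sub, hH, coeff_polyOf, if_pos hj, sub_eq_zero]
      split_ifs with h
      · rw [blockEntry_eq (K := K) t hj (by omega : e + j = e + j - d + d), ← mul_assoc, ← map_mul,
          inv_mul_cancel₀ (Nat.cast_ne_zero.2 (Nat.factorial_ne_zero _)), map_one, one_mul]
      · rw [mul_zero, coeff_diagPoly_mul_eq_zero t (by omega)]
    have heq : diagPoly d t e = polyOf d (H * expPoly R (-1 : K) d).coeff := by
      have h2 : X ^ d ∣ H * expPoly R (-1 : K) d - diagPoly d t e := by
        have h3 : H * expPoly R (-1 : K) d - diagPoly d t e =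
          (H - diagPoly d t e * expPoly R (1 : K) d) * expPoly R (-1 : K) d +
            diagPoly d t e * (expPoly R (1 : K) d * expPoly R (-1 : K) d - 1) := by ring
        rw [h3]
        exact dvd_add (hdvd.mul_right _) ((X_pow_dvd_expPoly_mul d).mul_left _)
      ext i
      rw [coeff_polyOf]
      split_ifs with hi
      · have := X_pow_dvd_iff.1 h2 i hi
        rw [coeff_sub, sub_eq_zero] at this
        exact this.symm
      · exact coeff_eq_zero_of_lt (natDegree_polyOf_lt hd _) (by omega)
    rw [heq]
    refine (Reach.coeffs_polyOf_mul hd (fun i _ => const_mem_avail _) fun j hj => ?_).bind'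
      (T := coeffs H) (c' := μ * d) (by linarith) fun S' _ hT => ?_
    · split_ifs with h
      · exact ht _ (by omega) _ hj
      · exact zero_mem_avail
    · exact (hμ.reach hN (natDegree_polyOf_lt hd _) (natDegree_polyOf_lt hd _) hT
        (coeffs_expPoly _ _)).of_subset (coeffs_polyOf fun i _ => subset_avail ⟨i, rfl⟩)
  · rintro v ⟨i, hi, m, hm, rfl⟩
    refine subset_avail (Set.mem_biUnion (Finset.mem_coe.2 (Finset.mem_range.2
      (by omega : i + d - m < 2 * d))) ⟨m, ?_⟩)
    rw [diagPoly, coeff_polyOf, if_pos hm, if_pos (by omega), show m + (i + d - m) - d = i by omega]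

end Block

/-! ### Operators and points as functions on the space of inputs -/

section Main

/-- The points and the coefficients of the operator. -/
abbrev Inputs (K : Type*) (d r p : ℕ) : Type _ :=
  {α : Fin p → K // Function.Injective α} × (Fin d × Fin r → K)

variable {K : Type*} [Field K] {d r p : ℕ}

/-- The `k`-th point, as a function of the input. -/
def pointFun (d r : ℕ) (k : ℕ) : Inputs K d r p → K :=
  fun x => if h : k < p then x.1.1 ⟨k, h⟩ else 0

/-- The coefficient of `x ^ i ∂ ^ j`, as a function of the input. -/
def coeffFun (p : ℕ) (i j : ℕ) : Inputs K d r p → K :=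
  fun x => if h : i < d ∧ j < r then x.2 (⟨i, h.1⟩, ⟨j, h.2⟩) else 0

/-- The coefficient of `∂ ^ m` in that of `x ^ i` in the twist by the `k`-th point, as a function
of the input. -/
noncomputable def twistFun (k i m : ℕ) : Inputs K d r p → K :=
  (taylor (pointFun d r k) (polyOf r (coeffFun p i))).coeff m

theorem twistFun_apply (k i m : ℕ) (x : Inputs K d r p) :
    twistFun k i m x = (taylor (pointFun d r k x) (delPoly x.2 i)).coeff m := by
  have h : (polyOf r (coeffFun p i)).map (Pi.evalRingHom (fun _ : Inputs K d r p => K) x) =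
      delPoly x.2 i := by
    ext j
    rw [coeff_map, delPoly, coeff_polyOf, coeff_polyOf]
    split_ifs <;> simp_all [coeffFun]
  rw [← h, ← Pi.evalRingHom_apply (fun _ : Inputs K d r p => K) x (pointFun d r k), ← map_taylor,
    coeff_map]
  rfl

theorem matrix_ofCoeffs_apply (hdr : d ≤ r) (x : Inputs K d r p) (s : Fin p × Fin (2 * d))
    (t : Fin p × Fin d) : ExpPoly.matrix x.1.1 (2 * d) d (DiffOp.ofCoeffs x.2) s t =
      if s.1 = t.1 then blockEntry d (twistFun t.1) s.2 t.2 x else 0 := by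
  rw [matrix_apply x.1.2]
  split_ifs with h
  · rw [DiffOp.polyMatrix, Matrix.of_apply, coeff_polyAction_X_pow hdr _ _ t.2.2, blockEntry,
      blockEntry, Finset.sum_apply]
    refine Finset.sum_congr rfl fun m _ => ?_
    rw [Pi.mul_apply, Pi.natCast_apply]
    congr 1
    split_ifs
    · rw [twistFun_apply]
      simp [pointFun]
    · rfl
  · rfl

instance [CharZero K] : Nonempty (Inputs K d r p) :=
  ⟨⟨⟨fun i => (i : ℕ), fun _ _ h => Fin.ext (Nat.cast_injective h)⟩, 0⟩⟩

variable (K d r p) in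
/-- The points. -/
def pointSet : Set (Inputs K d r p → K) := Set.range fun (k : Fin p) x => x.1.1 k

variable (K d r p) in
/-- The coefficients of the operator. -/
def coeffSet : Set (Inputs K d r p → K) := Set.range fun (e : Fin d × Fin r) x => x.2 e

variable (K d r p) in
/-- The entries of the matrix of the operator. -/
def matrixSet : Set (Inputs K d r p → K) :=
  Set.range fun (e : (Fin p × Fin (2 * d)) × (Fin p × Fin d)) x =>
    ExpPoly.matrix x.1.1 (2 * d) d (DiffOp.ofCoeffs x.2) e.1 e.2

theorem pointFun_mem {k : ℕ} (hk : k < p) : pointFun d r k ∈ pointSet K d r p :=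
  ⟨⟨k, hk⟩, funext fun x => by simp [pointFun, hk]⟩

theorem coeffFun_mem {i j : ℕ} (hi : i < d) (hj : j < r) : coeffFun p i j ∈ coeffSet K d r p :=
  ⟨(⟨i, hi⟩, ⟨j, hj⟩), funext fun x => by simp [coeffFun, hi, hj]⟩

theorem coeffSet_subset {A : Set (Inputs K d r p → K)}
    (h : ∀ i < d, ∀ j < r, coeffFun p i j ∈ A) : coeffSet K d r p ⊆ A := by
  rintro _ ⟨⟨i, j⟩, rfl⟩
  convert h i i.2 j j.2 using 1
  funext x
  simp [coeffFun]

theorem blockEntry_mem (hdr : d ≤ r) {k l j : ℕ} (hk : k < p) (hl : l < 2 * d) (hj : j < d) :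
    blockEntry d (twistFun k) l j ∈ matrixSet K d r p :=
  ⟨((⟨k, hk⟩, ⟨l, hl⟩), (⟨k, hk⟩, ⟨j, hj⟩)), funext fun x => by simp [matrix_ofCoeffs_apply hdr]⟩

theorem matrixSet_subset (hdr : d ≤ r) {S : Set (Inputs K d r p → K)}
    (h : ∀ k < p, ∀ l < 2 * d, ∀ j < d, blockEntry d (twistFun k) l j ∈ avail K S) :
    matrixSet K d r p ⊆ avail K S := by
  rintro _ ⟨⟨s, t⟩, rfl⟩
  by_cases hst : s.1 = t.1
  · convert h t.1 t.1.2 s.2 s.2.2 t.2 t.2.2 using 1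
    funext x
    simp [matrix_ofCoeffs_apply hdr, hst]
  · convert zero_mem_avail using 1
    funext x
    simp [matrix_ofCoeffs_apply hdr, hst]

/-- Inputs are restricted to distinct points precisely so that these functions are units. -/
theorem isUnit_pointFun_sub {j k : ℕ} (hj : j < p) (hk : k < p) (hjk : j ≠ k) :
    IsUnit (pointFun d r j - pointFun d r k : Inputs K d r p → K) := by
  rw [Pi.isUnit_iff]
  intro x
  rw [isUnit_iff_ne_zero, Pi.sub_apply, sub_ne_zero]
  simp only [pointFun, hj, hk, dif_pos]
  exact fun h => hjk (by simpa using x.1.2 h)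

/-- The left side is at most ⌊log₂ r⌋ + 4; as log r ≥ log 2 > 1/2, the two terms are at most 2 log r
and 8 log r. -/
theorem clog_four_mul_le {r : ℕ} (hr : 2 ≤ r) :
    (Nat.clog 2 (4 * r) : ℝ) + 1 ≤ 10 * Real.log r := by
  have hr0 : (0 : ℝ) < r := by exact_mod_cast (by omega : 0 < r)
  have h2 : (1 : ℝ) / 2 < Real.log 2 := by linarith [Real.log_two_gt_d9]
  have hlr : Real.log 2 ≤ Real.log r :=
    Real.log_le_log (by norm_num) (by exact_mod_cast hr)
  have h4 : Nat.clog 2 (4 * r) ≤ Nat.log 2 r + 3 := by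
    refine Nat.clog_le_of_le_pow ?_
    have := Nat.lt_pow_succ_log_self (b := 2) (by norm_num) r
    rw [show Nat.log 2 r + 3 = (Nat.log 2 r + 1) + 2 by ring, pow_add]
    omega
  have hlog : (Nat.log 2 r : ℝ) * Real.log 2 ≤ Real.log r := by
    rw [← Real.log_pow]
    refine Real.log_le_log (by positivity) ?_
    exact_mod_cast Nat.pow_log_le_self 2 (by omega)
  have h5 : (Nat.log 2 r : ℝ) ≤ 2 * Real.log r := by
    nlinarith [(Nat.cast_nonneg (Nat.log 2 r) : (0 : ℝ) ≤ Nat.log 2 r)]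
  have h6 : (Nat.clog 2 (4 * r) : ℝ) ≤ Nat.log 2 r + 3 := by exact_mod_cast h4
  linarith

/-! ### Total costs of the two directions. -/

section Cost

variable {μ : ℝ} [CharZero K]

/-- One Hermite evaluation for each power of x, then one conversion for each point; 56 = 2·22 + 2·6
by pd ≤ 2r. -/
theorem reach_matrixSet (hμ : MulBound K (Inputs K d r p → K) μ (4 * r)) (hd : 0 < d) (hdr : d ≤ r)
    (hp : 0 < p) (hrp : r ≤ p * d) (hpr : p * d < 2 * r) :
    Reach K (pointSet K d r p ∪ coeffSet K d r p) (56 * μ * r * d * (Nat.clog 2 (4 * r) + 1))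
      (matrixSet K d r p) := by
  have hμ0 : 0 ≤ μ := zero_le_one.trans hμ.1
  set S := pointSet K d r p ∪ coeffSet K d r p
  set L : ℝ := (Nat.clog 2 (4 * r) : ℝ) with hL
  have hL0 : 0 ≤ L := Nat.cast_nonneg _
  have hLp : (Nat.clog 2 (p * d) : ℝ) ≤ L := by
    rw [hL]
    exact_mod_cast Nat.clog_mono_right 2 (by omega)
  have hpd : (p : ℝ) * d ≤ 2 * r := by exact_mod_cast hpr.le
  refine (Reach.range (n := d) (c := 22 * μ * p * d * (L + 1)) (T := fun i =>
    ⋃ k ∈ Finset.range p, coeffs (polyOf d (taylor (pointFun d r k)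
      (polyOf r (coeffFun p i))).coeff)) fun i hi => ?_).bind' (c' := p * (6 * μ * d * d)) ?_
      fun S' _ hT => ?_
  · refine (hμ.hermite_eval hd hp (by omega)
      (fun k hk => subset_avail (Set.mem_union_left _ (pointFun_mem hk)))
      ((natDegree_polyOf_lt (by omega) _).trans_le hrp) (coeffs_polyOf fun j hj =>
        subset_avail (Set.mem_union_right _ (coeffFun_mem hi hj)))).le ?_
    gcongr
  · have h1 : 22 * μ * (p * d) * (L + 1) * d ≤ 22 * μ * (2 * r) * (L + 1) * d := by gcongr
    have h2 : 6 * μ * (p * d) * d ≤ 6 * μ * (2 * r) * d := by gcongr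
    have h3 : 0 ≤ μ * r * d * L := by positivity
    linarith
  · refine (Reach.range (n := p) (T := fun k => {v | ∃ l < 2 * d, ∃ j < d,
      v = blockEntry d (twistFun k) l j}) fun k hk => ?_).of_subset ?_
    · refine hμ.reach_blockEntry hd (by omega) fun i hi m hm => ?_
      have h1 := (biUnion_subset_iff.1 (biUnion_subset_iff.1 hT i hi)) k hk
      have h2 := coeffs_subset.1 h1 m
      rwa [coeff_polyOf, if_pos hm] at h2
    · refine matrixSet_subset hdr fun k hk l hl j hj => subset_avail ?_
      exact Set.mem_biUnion (Finset.mem_coe.2 (Finset.mem_range.2 hk)) ⟨l, hl, j, hj, rfl⟩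

/-- The conversions are inverted first, then each coefficient polynomial in ∂ is interpolated; 138 =
2·65 + 2·4. -/
theorem reach_coeffSet (hμ : MulBound K (Inputs K d r p → K) μ (4 * r)) (hd : 0 < d) (hdr : d ≤ r)
    (hp : 0 < p) (hrp : r ≤ p * d) (hpr : p * d < 2 * r) :
    Reach K (pointSet K d r p ∪ matrixSet K d r p) (138 * μ * r * d * (Nat.clog 2 (4 * r) + 1))
      (coeffSet K d r p) := by
  have hμ0 : 0 ≤ μ := zero_le_one.trans hμ.1
  have h2pd : p * (2 * d) = 2 * (p * d) := by ring
  set S := pointSet K d r p ∪ matrixSet K d r p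
  set L : ℝ := (Nat.clog 2 (4 * r) : ℝ) with hL
  have hL0 : 0 ≤ L := Nat.cast_nonneg _
  have hLp : (Nat.clog 2 (p * (2 * d)) : ℝ) ≤ L := by
    rw [hL]
    exact_mod_cast Nat.clog_mono_right 2 (by omega)
  have hpd : (p : ℝ) * d ≤ 2 * r := by exact_mod_cast hpr.le
  refine (Reach.range (n := p) (c := 4 * μ * d * d) (T := fun k => {v | ∃ i < d, ∃ m < d,
    v = twistFun k i m}) fun k hk => ?_).bind' (c' := d * (65 * μ * p * d * (L + 1))) ?_
    fun S' hS hT => ?_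
  · exact hμ.reach_of_blockEntry hd (by omega) fun l hl j hj =>
      subset_avail (Set.mem_union_right _ (blockEntry_mem hdr hk hl hj))
  · have h1 : 65 * μ * (p * d) * (L + 1) * d ≤ 65 * μ * (2 * r) * (L + 1) * d := by gcongr
    have h2 : 4 * μ * (p * d) * d ≤ 4 * μ * (2 * r) * d := by gcongr
    have h3 : 0 ≤ μ * r * d * L := by positivity
    linarith
  · rw [biUnion_subset_iff] at hT
    refine (Reach.range (n := d) (T := fun i => coeffs (polyOf r (coeffFun p i)))
      fun i hi => ?_).of_subset (coeffSet_subset fun i hi j hj => ?_)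
    · refine (hμ.hermite_interp hd hp (by omega) (α := pointFun d r)
        (fun k hk => subset_avail (hS (Set.mem_union_left _ (pointFun_mem hk))))
        (fun j hj k hk hjk => isUnit_pointFun_sub hj hk hjk)
        ((natDegree_polyOf_lt (by omega) _).trans_le hrp)
        fun k hk => coeffs_polyOf fun m hm => hT k hk ⟨i, hi, m, hm, rfl⟩).le ?_
      gcongr
    · refine subset_avail (Set.mem_biUnion (Finset.mem_coe.2 (Finset.mem_range.2 hi)) ⟨j, ?_⟩)
      rw [coeff_polyOf, if_pos hj]

end Cost

/-! ### The case r = 1, where log r = 0 leaves no operations, and the final bounds. -/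

theorem blockEntry_one (l : ℕ) : blockEntry (R := Inputs K 1 1 p → K) 1 (twistFun 0) l 0 =
    if l = 0 then coeffFun p 0 0 else 0 := by
  have h : twistFun 0 0 0 = (coeffFun p 0 0 : Inputs K 1 1 p → K) := by
    rw [twistFun, show polyOf 1 (coeffFun p 0 : ℕ → Inputs K 1 1 p → K) = C (coeffFun p 0 0) by
      simp [polyOf], taylor_C, coeff_C_zero]
  rw [blockEntry]
  rcases Nat.eq_zero_or_pos l with rfl | hl
  · simp [h]
  · simp [hl.ne']

theorem reach_matrixSet_one : Reach K (pointSet K 1 1 1 ∪ coeffSet K 1 1 1) 0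
    (matrixSet K 1 1 1) := by
  refine .done le_rfl (matrixSet_subset le_rfl fun k hk l _ j hj => ?_)
  obtain rfl : k = 0 := by omega
  obtain rfl : j = 0 := by omega
  rw [blockEntry_one]
  split_ifs
  · exact subset_avail (.inr (coeffFun_mem (by omega) (by omega)))
  · exact zero_mem_avail

theorem reach_coeffSet_one : Reach K (pointSet K 1 1 1 ∪ matrixSet K 1 1 1) 0
    (coeffSet K 1 1 1) := by
  refine .done le_rfl (coeffSet_subset fun i hi j hj => ?_)
  obtain rfl : i = 0 := by omega
  obtain rfl : j = 0 := by omega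
  have := blockEntry_mem (K := K) (d := 1) (r := 1) (p := 1) (k := 0) (l := 0) (j := 0) le_rfl
    (by omega) (by omega) (by omega)
  rw [blockEntry_one, if_pos rfl] at this
  exact subset_avail (.inr this)

theorem reach_both [CharZero K] {M : ℕ → ℝ} (hM : IsMulTime K M) (hd : 0 < d) (hdr : d ≤ r)
    (hp : p = ⌈(r : ℚ) / (d : ℚ)⌉₊) :
    Reach K (pointSet K d r p ∪ coeffSet K d r p) (300000 * (d * M r * Real.log r))
      (matrixSet K d r p) ∧
    Reach K (pointSet K d r p ∪ matrixSet K d r p) (300000 * (d * M r * Real.log r))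
      (coeffSet K d r p) := by
  have hdQ : (0 : ℚ) < d := by exact_mod_cast hd
  have hrp : r ≤ p * d := by
    have := Nat.le_ceil ((r : ℚ) / d)
    rw [← hp, div_le_iff₀ hdQ] at this
    exact_mod_cast this
  have hpr : p * d < 2 * r := by
    have := Nat.ceil_lt_add_one (a := (r : ℚ) / d) (by positivity)
    rw [← hp, ← sub_lt_iff_lt_add, lt_div_iff₀ hdQ, sub_mul, one_mul, sub_lt_iff_lt_add] at this
    have : p * d < r + d := by exact_mod_cast this
    omega
  have hp0 : 0 < p := Nat.pos_of_ne_zero fun h => by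
    rw [h] at hrp
    omega
  rcases Nat.lt_or_ge r 2 with hr | hr
  · obtain rfl : r = 1 := by omega
    obtain rfl : d = 1 := by omega
    obtain rfl : p = 1 := by omega
    simpa using ⟨reach_matrixSet_one, reach_coeffSet_one⟩
  · have hμ := mulBound_of_isMulTime hM (D := Inputs K d r p) (r := r) (by omega)
    have hr0 : (0 : ℝ) < r := by exact_mod_cast (by omega : 0 < r)
    have hlog := clog_four_mul_le hr
    have hM0 : 0 ≤ M r := by
      have h1 := hμ.1
      by_contra hneg
      have := div_neg_of_neg_of_pos (not_le.1 hneg) hr0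
      linarith
    -- The absolute constant: 196 · 138 · 10 = 270480 is below 300000.
    have key : ∀ c : ℝ, 0 ≤ c → c ≤ 138 → c * (196 * (M r / r)) * r * d *
        (Nat.clog 2 (4 * r) + 1) ≤ 300000 * (d * M r * Real.log r) := fun c hc hc' => by
      have h1 : c * (196 * (M r / r)) * r * d * (Nat.clog 2 (4 * r) + 1) =
          196 * c * (d * M r) * (Nat.clog 2 (4 * r) + 1) := by
        field_simp
      rw [h1]
      have h0 : 0 ≤ Real.log r := Real.log_nonneg (by exact_mod_cast (by omega : 1 ≤ r))
      have h2 : 196 * c * (d * M r) * (Nat.clog 2 (4 * r) + 1) ≤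
          196 * 138 * (d * M r) * (10 * Real.log r) := by gcongr
      have h3 : 0 ≤ d * M r * Real.log r := by positivity
      linarith
    exact ⟨(reach_matrixSet hμ hd hdr hp0 hrp hpr).le (key 56 (by norm_num) (by norm_num)),
      (reach_coeffSet hμ hd hdr hp0 hrp hpr).le (key 138 (by norm_num) le_rfl)⟩

theorem exists_programs [CharZero K] {M : ℕ → ℝ} (hM : IsMulTime K M) (hd : 0 < d) (hdr : d ≤ r)
    (hp : p = ⌈(r : ℚ) / (d : ℚ)⌉₊) :
    (∃ P : SLP K (Fin p ⊕ Fin d × Fin r) ((Fin p × Fin (2 * d)) × (Fin p × Fin d)),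
      (P.cost : ℝ) ≤ 300000 * (d * M r * Real.log r) ∧
      ∀ α : Fin p → K, Function.Injective α → ∀ c : Fin d × Fin r → K,
        P.Computes (Sum.elim α c)
          (fun e => ExpPoly.matrix α (2 * d) d (DiffOp.ofCoeffs c) e.1 e.2)) ∧
    ∃ Q : SLP K (Fin p ⊕ (Fin p × Fin (2 * d)) × (Fin p × Fin d)) (Fin d × Fin r),
      (Q.cost : ℝ) ≤ 300000 * (d * M r * Real.log r) ∧
      ∀ α : Fin p → K, Function.Injective α → ∀ c : Fin d × Fin r → K,
        Q.Computes
          (Sum.elim α (fun e => ExpPoly.matrix α (2 * d) d (DiffOp.ofCoeffs c) e.1 e.2)) c := by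
  obtain ⟨h1, h2⟩ := reach_both hM hd hdr hp
  constructor
  · obtain ⟨P, hP, H⟩ := exists_program_of_reach (D := Inputs K d r p)
      (a := fun x => Sum.elim x.1.1 x.2)
      (y := fun x (e : (Fin p × Fin (2 * d)) × (Fin p × Fin d)) =>
        ExpPoly.matrix x.1.1 (2 * d) d (DiffOp.ofCoeffs x.2) e.1 e.2)
      (h1.mono (by
        rintro _ (⟨k, rfl⟩ | ⟨e, rfl⟩)
        · exact subset_avail ⟨.inl k, rfl⟩
        · exact subset_avail ⟨.inr e, rfl⟩) le_rfl)
    exact ⟨P, hP, fun α hα c => H (⟨α, hα⟩, c)⟩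
  · obtain ⟨P, hP, H⟩ := exists_program_of_reach (D := Inputs K d r p)
      (a := fun x => Sum.elim x.1.1
        fun e : (Fin p × Fin (2 * d)) × (Fin p × Fin d) =>
          ExpPoly.matrix x.1.1 (2 * d) d (DiffOp.ofCoeffs x.2) e.1 e.2)
      (y := fun x e => x.2 e)
      (h2.mono (by
        rintro _ (⟨k, rfl⟩ | ⟨e, rfl⟩)
        · exact subset_avail ⟨.inl k, rfl⟩
        · exact subset_avail ⟨.inr e, rfl⟩) le_rfl)
    exact ⟨P, hP, fun α hα c => H (⟨α, hα⟩, c)⟩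

end Main

end StraightLine

theorem lemma2 :
    ∃ C : ℝ, ∀ (K : Type*) [Field K] [CharZero K] (M : ℕ → ℝ), IsMulTime K M →
      ∀ d r p : ℕ, 0 < d → d ≤ r → p = ⌈(r : ℚ) / (d : ℚ)⌉₊ →
        -- the matrix is the matrix of `L`, and it is block diagonal
        (∀ α : Fin p → K, Function.Injective α → ∀ L ∈ DiffOp.bidegreeLT K d r,
          (∀ t : Fin p × Fin d, ExpPoly.action K L (ExpPoly.mono (α t.1) t.2) =
            ∑ s : Fin p × Fin (2 * d),
              ExpPoly.matrix α (2 * d) d L s t • ExpPoly.mono (α s.1) s.2) ∧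
          ∀ (s : Fin p × Fin (2 * d)) (t : Fin p × Fin d),
            ExpPoly.matrix α (2 * d) d L s t =
              if s.1 = t.1 then
                DiffOp.polyMatrix (2 * d) d (DiffOp.twist (α t.1) L) s.2 t.2
              else 0) ∧
        -- the matrix can be computed from `L` (and the points)
        (∃ P : SLP K (Fin p ⊕ Fin d × Fin r) ((Fin p × Fin (2 * d)) × (Fin p × Fin d)),
          (P.cost : ℝ) ≤ C * (d * M r * Real.log r) ∧
          ∀ α : Fin p → K, Function.Injective α → ∀ c : Fin d × Fin r → K,
            P.Computes (Sum.elim α c)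
              (fun e => ExpPoly.matrix α (2 * d) d (DiffOp.ofCoeffs c) e.1 e.2)) ∧
        -- the matrix determines `L`
        (∀ α : Fin p → K, Function.Injective α →
          Set.InjOn (ExpPoly.matrix α (2 * d) d) (DiffOp.bidegreeLT K d r)) ∧
        -- `L` can be recovered from the matrix (and the points)
        (∃ Q : SLP K (Fin p ⊕ (Fin p × Fin (2 * d)) × (Fin p × Fin d)) (Fin d × Fin r),
          (Q.cost : ℝ) ≤ C * (d * M r * Real.log r) ∧
          ∀ α : Fin p → K, Function.Injective α → ∀ c : Fin d × Fin r → K,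
            Q.Computes
              (Sum.elim α (fun e => ExpPoly.matrix α (2 * d) d (DiffOp.ofCoeffs c) e.1 e.2))
              c) := by
  refine ⟨300000, fun K _ _ M hM d r p hd hdr hp => ?_⟩
  obtain ⟨hP, hQ⟩ := StraightLine.exists_programs hM hd hdr hp
  refine ⟨?_, hP, ?_, hQ⟩
  · rintro α hα _ ⟨c, rfl⟩
    exact ⟨StraightLine.action_mono_eq_sum hdr hα c, StraightLine.matrix_apply hα _⟩
  · rintro α hα _ ⟨c, rfl⟩ _ ⟨c', rfl⟩ h
    -- One program maps the common matrix to both coefficient families, so they coincide.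
    obtain ⟨Q, -, H⟩ := hQ
    have h1 := H α hα c
    rw [h] at h1
    rw [StraightLine.computes_unique h1 (H α hα c')]
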